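/- Model. An energy word RAM with word size $w\ge 1$ runs a fixed program, which does not depend on $w$ or on the input. Array elements (keys) are $w$-bit words; a program may only compare two keys, swap them, copy a key into an empty (zero) cell, erase a known copy of a key, or overwrite a key, so that every algorithm is comparison-based. Lengths, indices, addresses, counters and comparison bits are stored in index cells of $K$ words each ($Kw$ bits), where the constant $K$ is part of the program; key cells and index memory cells are accessed through addresses held in variables (which are index cells). Each operation on $O(1)$ cells takes one time step. On index cells the reversible operations are in-place addition and subtraction, increment, decrement, negation of a bit, swap, and adding to (or subtracting from) a cell the bit $[x\le y]$ for two index cells or two keys $x,y$; these and the reversible key operations (comparison, swap, copying into an empty cell, erasing a known copy) cost no energy. The irreversible operations cost energy: bitwise AND and OR cost $1$ per word, and overwriting costs the number of bits overwritten. Control flow consists of (conditional) jumps, each of which has to land on a (conditional) "comefrom" line that is paired with it and whose condition tells whether the line was reached by the jump or from the line above. The auxiliary space is the number of words in all cells accessed during the run, other than the cells of the input array and of the output array. A program is reversible if, for every word size, every machine configuration has at most one predecessor configuration. Theorem. For every constant $C$ there are a reversible program $P$ and constants $c_1,c_2>0$ such that for all integers $w\ge 1$ and $n\ge 0$ with $\lg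 n\le C w$ (where $\lg=\log_2$, with the convention $\lg 0=0$) and for every array $L$ of $n$ $w$-bit elements, the following holds. Started with $L$ in memory, with $n$ in one variable and everything else zero, $P$ halts with $L$ unchanged, with the sorted rearrangement of $L$ stored in the $n$ cells following it, and with all other storage restored to its initial contents. The run consumes energy exactly $0$, takes a number $T$ of steps with $$c_1\, n\lg n \;\le\; T \;\le\; c_2\,(n\lg n+1),$$ and uses an amount $S$ of auxiliary space (in words) with $$c_1\, n \;\le\; S \;\le\; c_2\,(n+1).$$ In particular the time is $\Theta(n\lg n)$ and the auxiliary space is $\Theta(n)$. -/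

import Mathlib

/-! An energy word RAM for comparison-based algorithms.

Words have `w` bits.  Array elements ("keys") are single words which a program may only copy, move,
erase against a known equal copy, and compare; everything else (the length of the input, indices,
addresses, counters, comparison bits) lives in index cells, each made of a constant number `K` of
words.  `K` belongs to the program and does not depend on `w` or on the input. -/

namespace EnergyRAM

/-- Index cells: the finitely many variables that a program names, and a memory of cells that are
reached through an address held in a variable. -/
inductive ICell where
  | var (i : ℕ)
  | mem (a : ℕ)
deriving DecidableEq

/-- All storage cells: index cells and key cells. -/
inductive Cell where
  | idx (c : ICell)
  | key (a : ℕ)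
deriving DecidableEq

/-- Number of words that a cell occupies. -/
def Cell.words (K : ℕ) : Cell → ℕ
  | .idx _ => K
  | .key _ => 1

/-- Contents of the storage. -/
structure State (K w : ℕ) where
  idx : ICell → BitVec (K * w)
  key : ℕ → BitVec w

/-- Operands that denote index cells: the variable `i`, or the memory cell whose address is the
value of the variable `i`. -/
inductive Loc where
  | var (i : ℕ)
  | ptr (i : ℕ)

/-- The address held in variable `i`. -/
def State.addr {K w : ℕ} (s : State K w) (i : ℕ) : ℕ := (s.idx (.var i)).toNat

/-- The index cell denoted by an operand. -/
def Loc.cell {K w : ℕ} (s : State K w) : Loc → ICell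
  | .var i => .var i
  | .ptr i => .mem (s.addr i)

/-- The variables used as addresses by an operand. -/
def Loc.ptrs : Loc → List ℕ
  | .var _ => []
  | .ptr i => [i]

/-- The value of the index cell denoted by an operand. -/
def State.val {K w : ℕ} (s : State K w) (a : Loc) : BitVec (K * w) := s.idx (a.cell s)

/-- The key whose address is held in variable `p`. -/
def State.keyAt {K w : ℕ} (s : State K w) (p : ℕ) : BitVec w := s.key (s.addr p)

/-- Write `x` into the index cell denoted by `a`. -/
def State.write {K w : ℕ} (s : State K w) (a : Loc) (x : BitVec (K * w)) : State K w :=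
  { s with idx := Function.update s.idx (a.cell s) x }

/-- Write `x` into the key cell whose address is held in variable `p`. -/
def State.writeKey {K w : ℕ} (s : State K w) (p : ℕ) (x : BitVec w) : State K w :=
  { s with key := Function.update s.key (s.addr p) x }

/-- The comparison bit. -/
def bit {m k : ℕ} (x y : BitVec k) : BitVec m := if x ≤ y then 1 else 0

/-- Word operations.  Key operands are given by the variables that hold their addresses.  The last
four operations are irreversible. -/
inductive Op where
  /-- `a += b`; this is also `Copy(b, a)` when `a` is empty -/
  | add (a b : Loc)
  /-- `a -= b`; this is also `DestroyCopy(b, a)` when `a = b` -/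
  | sub (a b : Loc)
  | inc (a : Loc)
  | dec (a : Loc)
  /-- logical negation of a bit -/
  | not (a : Loc)
  | swap (a b : Loc)
  /-- `c += [a ≤ b]` -/
  | le (a b c : Loc)
  /-- `c -= [a ≤ b]` -/
  | invLe (a b c : Loc)
  /-- copy the key at `p` into the empty key cell at `q` -/
  | keyCopy (p q : ℕ)
  /-- empty the key cell at `q`, which is known to hold a copy of the key at `p` -/
  | keyDestroyCopy (p q : ℕ)
  | keySwap (p q : ℕ)
  /-- `c += [key at p ≤ key at q]` -/
  | keyLe (p q : ℕ) (c : Loc)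
  /-- `c -= [key at p ≤ key at q]` -/
  | keyInvLe (p q : ℕ) (c : Loc)
  /-- `a = a AND b`, bitwise -/
  | and (a b : Loc)
  /-- `a = a OR b`, bitwise -/
  | or (a b : Loc)
  /-- overwrite `a` by `b` -/
  | set (a b : Loc)
  /-- overwrite the key at `q` by the key at `p` -/
  | keySet (p q : ℕ)

namespace Op

/-- Energy cost in bits: bitwise `And` and `Or` cost one unit per word, overwriting costs all the
bits that are overwritten, the reversible operations are free. -/
def energy (K w : ℕ) : Op → ℕ
  | and _ _ => K
  | or _ _ => K
  | set _ _ => K * w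
  | keySet _ _ => w
  | _ => 0

/-- The variables that an operation uses as addresses. -/
def ptrs : Op → List ℕ
  | add a b | sub a b | swap a b | and a b | or a b | set a b => a.ptrs ++ b.ptrs
  | inc a | dec a | not a => a.ptrs
  | le a b c | invLe a b c => a.ptrs ++ b.ptrs ++ c.ptrs
  | keyCopy p q | keyDestroyCopy p q | keySwap p q | keySet p q => [p, q]
  | keyLe p q c | keyInvLe p q c => [p, q] ++ c.ptrs

variable {K w : ℕ}

/-- The index cells that an operation uses as operands. -/
def operands (s : State K w) : Op → List ICell
  | add a b | sub a b | swap a b | and a b | or a b | set a b => [a.cell s, b.cell s]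
  | inc a | dec a | not a => [a.cell s]
  | le a b c | invLe a b c => [a.cell s, b.cell s, c.cell s]
  | keyCopy _ _ | keyDestroyCopy _ _ | keySwap _ _ | keySet _ _ => []
  | keyLe _ _ c | keyInvLe _ _ c => [c.cell s]

/-- The index cells that an operation writes. -/
def writes (s : State K w) : Op → List ICell
  | add a _ | sub a _ | inc a | dec a | not a | and a _ | or a _ | set a _ => [a.cell s]
  | swap a b => [a.cell s, b.cell s]
  | le _ _ c | invLe _ _ c | keyLe _ _ c | keyInvLe _ _ c => [c.cell s]
  | keyCopy _ _ | keyDestroyCopy _ _ | keySwap _ _ | keySet _ _ => []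

/-- The key cells that an operation uses. -/
def keys (s : State K w) : Op → List ℕ
  | keyCopy p q | keyDestroyCopy p q | keySwap p q | keySet p q | keyLe p q _ | keyInvLe p q _ =>
      [s.addr p, s.addr q]
  | _ => []

/-- All the cells that an operation accesses. -/
def touched (s : State K w) (o : Op) : Finset Cell :=
  (o.ptrs.map fun i => Cell.idx (.var i)).toFinset ∪ ((o.operands s).map Cell.idx).toFinset ∪
    ((o.keys s).map Cell.key).toFinset

/-- The promise under which an individual operation may be applied. -/
def Promise (s : State K w) : Op → Prop
  | add a b | sub a b => a.cell s ≠ b.cell s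
  | le a b c | invLe a b c => a.cell s ≠ c.cell s ∧ b.cell s ≠ c.cell s
  | not a => s.val a = 0 ∨ s.val a = 1
  | keyCopy p q => s.addr p ≠ s.addr q ∧ s.keyAt q = 0
  | keyDestroyCopy p q => s.addr p ≠ s.addr q ∧ s.keyAt q = s.keyAt p
  | _ => True

/-- An operation may be applied when its promise holds and it does not change a variable that it
uses as an address; otherwise the machine is stuck. -/
def Admissible (s : State K w) (o : Op) : Prop :=
  o.Promise s ∧ ∀ i ∈ o.ptrs, ICell.var i ∉ o.writes s

/-- The effect of an operation. -/
def exec (s : State K w) : Op → State K w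
  | add a b => s.write a (s.val a + s.val b)
  | sub a b => s.write a (s.val a - s.val b)
  | inc a => s.write a (s.val a + 1)
  | dec a => s.write a (s.val a - 1)
  | not a => s.write a (1 - s.val a)
  | swap a b =>
      { s with
        idx := Function.update (Function.update s.idx (a.cell s) (s.val b)) (b.cell s) (s.val a) }
  | le a b c => s.write c (s.val c + bit (s.val a) (s.val b))
  | invLe a b c => s.write c (s.val c - bit (s.val a) (s.val b))
  | keyCopy p q => s.writeKey q (s.keyAt p)
  | keyDestroyCopy _ q => s.writeKey q 0
  | keySwap p q => (s.writeKey p (s.keyAt q)).writeKey q (s.keyAt p)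
  | keyLe p q c => s.write c (s.val c + bit (s.keyAt p) (s.keyAt q))
  | keyInvLe p q c => s.write c (s.val c - bit (s.keyAt p) (s.keyAt q))
  | and a b => s.write a (s.val a &&& s.val b)
  | or a b => s.write a (s.val a ||| s.val b)
  | set a b => s.write a (s.val b)
  | keySet p q => s.writeKey q (s.keyAt p)

end Op

/-- Conditions of branches. -/
inductive Cond where
  | always
  | nonzero (i : ℕ)
  | zero (i : ℕ)

def Cond.Holds {K w : ℕ} (s : State K w) : Cond → Prop
  | .always => True
  | .nonzero i => s.idx (.var i) ≠ 0
  | .zero i => s.idx (.var i) = 0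

def Cond.touched : Cond → Finset Cell
  | .always => ∅
  | .nonzero i => {Cell.idx (.var i)}
  | .zero i => {Cell.idx (.var i)}

/-- Lines of code: operations, (conditional) jumps `goto`, and their (conditional) partners
`comefrom`. -/
inductive Instr where
  | op (o : Op)
  | goto (c : Cond) (target : ℕ)
  | comefrom (c : Cond) (source : ℕ)

/-- A program: its lines, and the number `K` of words in an index cell. -/
structure Program where
  K : ℕ
  code : List Instr

structure Config (K w : ℕ) where
  pc : ℕ
  state : State K w

namespace Program

variable {w : ℕ}

/-- Line `l` may be entered in state `s` from the line above it: if line `l` is a `comefrom`, its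
condition must say that it was not reached by a jump. -/
def EntersFromAbove (P : Program) (l : ℕ) (s : State P.K w) : Prop :=
  ∀ c source, P.code[l]? = some (.comefrom c source) → ¬ c.Holds s

/-- One step of the machine.  A jump has to land on a `comefrom` that is paired with it and whose
condition says that it was reached by the jump.  The machine is stuck where no rule applies. -/
inductive Step (P : Program) : Config P.K w → Config P.K w → Prop
  | op {pc : ℕ} {s : State P.K w} {o : Op} :
      P.code[pc]? = some (.op o) → o.Admissible s → P.EntersFromAbove (pc + 1) (o.exec s) →
      Step P ⟨pc, s⟩ ⟨pc + 1, o.exec s⟩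
  | goto {pc target : ℕ} {s : State P.K w} {c c' : Cond} :
      P.code[pc]? = some (.goto c target) → c.Holds s →
      P.code[target]? = some (.comefrom c' pc) → c'.Holds s →
      Step P ⟨pc, s⟩ ⟨target, s⟩
  | noGoto {pc target : ℕ} {s : State P.K w} {c : Cond} :
      P.code[pc]? = some (.goto c target) → ¬ c.Holds s → P.EntersFromAbove (pc + 1) s →
      Step P ⟨pc, s⟩ ⟨pc + 1, s⟩
  | comefrom {pc source : ℕ} {s : State P.K w} {c : Cond} :
      P.code[pc]? = some (.comefrom c source) → P.EntersFromAbove (pc + 1) s →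
      Step P ⟨pc, s⟩ ⟨pc + 1, s⟩

/-- Energy spent by the step taken from a configuration. -/
def energyAt (P : Program) (x : Config P.K w) : ℕ :=
  match P.code[x.pc]? with
  | some (.op o) => o.energy P.K w
  | _ => 0

/-- Cells accessed by the step taken from a configuration. -/
def touchedAt (P : Program) (x : Config P.K w) : Finset Cell :=
  match P.code[x.pc]? with
  | some (.op o) => o.touched x.state
  | some (.goto c _) => c.touched
  | some (.comefrom c _) => c.touched
  | none => ∅

/-- `P.Run x T E A y`: the machine goes from `x` to `y` in `T` steps, spends energy `E` in total,
and the set of cells that it accesses on the way is `A`. -/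
inductive Run (P : Program) : Config P.K w → ℕ → ℕ → Finset Cell → Config P.K w → Prop
  | refl (x : Config P.K w) : Run P x 0 0 ∅ x
  | step {x y z : Config P.K w} {T E : ℕ} {A : Finset Cell} :
      P.Step x y → Run P y T E A z →
      Run P x (T + 1) (P.energyAt x + E) (P.touchedAt x ∪ A) z

/-- Instantaneous reversibility: for every word size, every configuration has at most one
predecessor. -/
def Reversible (P : Program) : Prop :=
  ∀ (w : ℕ) (x x' y : Config P.K w), P.Step x y → P.Step x' y → x = x'

end Program

/-- The index storage at the start and at the end: variable `0` holds the length of the input,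
everything else is empty. -/
def lengthOnly (K w n : ℕ) (c : ICell) : BitVec (K * w) :=
  if c = .var 0 then BitVec.ofNat (K * w) n else 0

/-- Start of the computation on the array `L`, stored in the key cells `0, …, n - 1`. -/
def startConfig (P : Program) {w n : ℕ} (L : Fin n → BitVec w) : Config P.K w where
  pc := 0
  state :=
    { idx := lengthOnly P.K w n
      key := fun a => if h : a < n then L ⟨a, h⟩ else 0 }

/-- End of the computation with output `R`: the program has run past its last line, the storage is
as it was at the start except that `R` is stored in the key cells `n, …, 2 n - 1`. -/
def endConfig (P : Program) {w n : ℕ} (L R : Fin n → BitVec w) : Config P.K w where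
  pc := P.code.length
  state :=
    { idx := lengthOnly P.K w n
      key := fun a =>
        if h : a < n then L ⟨a, h⟩ else if h' : a - n < n then R ⟨a - n, h'⟩ else 0 }

/-- Number of words in the accessed cells other than those of the input and output arrays. -/
def auxWords (K n : ℕ) (A : Finset Cell) : ℕ :=
  ∑ c ∈ A \ (Finset.range (2 * n)).image Cell.key, c.words K

/-- `R` is the array `L` in sorted order. -/
def IsSortedCopy {w n : ℕ} (L R : Fin n → BitVec w) : Prop :=
  (∀ i j : Fin n, i ≤ j → R i ≤ R j) ∧ ∃ σ : Equiv.Perm (Fin n), ∀ i, R i = L (σ i)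

end EnergyRAM

/-! The method is to compute, copy the result, and uncompute. Every free operation can be undone by
a free operation, and a loop that tests one variable on entry and another on exit is undone by
exchanging the two tests around the inverse body. So a structured program has an inverse that
retraces its execution in the same time and in the same cells (`Stmt.Exec.inv`). Sorting accesses
only the input keys and the empty key cell at address `2 * n`; hence it can still be retraced after
the output cells between them have been filled (`Stmt.Exec.replaceKeys`). Reversibility of the
compiled program is syntactic: operations are injective, and each paired `comefrom` tells a jump
from a fall-through (`Program.reversible_of_isFree`).

What remains is a sort whose history fits into `O(n)` words, although it makes about `n lg n`
comparisons. It is a heap sort on a complete binary tree with `2 ^ m` leaves, `2 ^ m = O(n + 1)`.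
Removing the root leaves a hole, which always sinks to the bottom by pulling up the larger child.
The leaf that it reaches determines its whole path, so one recorded leaf address per extraction
replaces `m` comparison bits. The tree is numbered so that the children of offset `x` at depth `d`
have offsets `x` and `2 ^ d + x`; each comparison bit can then be recomputed from the new address of
the hole and erased at once (`yields_pullBody`).

The tree needs no sifting at the start: all inner nodes receive a copy of one largest element, which
makes it a heap. The price is `2 ^ m - 1` additional extractions. Since the extracted values
descend, they consist of `2 ^ m - 1` copies of the maximum followed by the array in descending order
(`eq_replicate_append`, `ExtractInv.isSorted`). Elements are represented by numbers, where `0`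
stands for the empty key cell, whose key is the least possible; blank memory thus serves as padding
of the leaves and as the hole.

Each extraction sinks exactly `m` levels, so the running time depends only on `n`: it is `2 ^ m - 1
+ n` rounds of `Θ(m)` steps plus lower-order terms. The space is linear by the bound on addresses;
it is at least `n` because the recorded leaf addresses are nonzero, while a cell that is never
accessed stays zero. -/

namespace EnergyRAM

/-! ### Inverses of the free operations -/

namespace Op

/-- The operations that cost no energy. -/
def IsFree : Op → Prop
  | and _ _ | or _ _ | set _ _ | keySet _ _ => False
  | _ => True

/-- The operation that undoes a free operation. -/
def inv : Op → Op
  | add a b => sub a b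
  | sub a b => add a b
  | inc a => dec a
  | dec a => inc a
  | le a b c => invLe a b c
  | invLe a b c => le a b c
  | keyCopy p q => keyDestroyCopy p q
  | keyDestroyCopy p q => keyCopy p q
  | keyLe p q c => keyInvLe p q c
  | keyInvLe p q c => keyLe p q c
  | o => o

theorem IsFree.inv {o : Op} (h : o.IsFree) : o.inv.IsFree := by
  cases o <;> simp_all [IsFree, Op.inv]

theorem IsFree.energy_eq_zero {o : Op} (h : o.IsFree) (K w : ℕ) : o.energy K w = 0 := by
  cases o <;> simp_all [IsFree, Op.energy]

variable {K w : ℕ} {s : State K w} {o : Op}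

theorem exec_idx_of_notMem_writes {c : ICell} (h : c ∉ o.writes s) :
    (o.exec s).idx c = s.idx c := by
  cases o <;> simp_all [writes, exec, State.write, State.writeKey]

theorem writes_subset_operands : o.writes s ⊆ o.operands s := by
  cases o <;> simp [writes, operands]

theorem exec_idx_of_notMem_touched {c : ICell} (h : Cell.idx c ∉ o.touched s) :
    (o.exec s).idx c = s.idx c := by
  refine exec_idx_of_notMem_writes fun hc => h ?_
  simp only [touched, Finset.mem_union, List.mem_toFinset, List.mem_map]
  exact Or.inl (Or.inr ⟨c, writes_subset_operands hc, rfl⟩)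

theorem Admissible.addr_exec (h : o.Admissible s) {i : ℕ} (hi : i ∈ o.ptrs) :
    (o.exec s).addr i = s.addr i := by
  simp only [State.addr, exec_idx_of_notMem_writes (h.2 i hi)]

theorem Admissible.cell_exec (h : o.Admissible s) {a : Loc} (ha : ∀ i ∈ a.ptrs, i ∈ o.ptrs) :
    a.cell (o.exec s) = a.cell s := by
  cases a with
  | var i => rfl
  | ptr i => simp only [Loc.cell, h.addr_exec (ha i (by simp [Loc.ptrs]))]

@[simp] theorem ptrs_inv : o.inv.ptrs = o.ptrs := by cases o <;> rfl

theorem operands_inv_exec (h : o.Admissible s) : o.inv.operands (o.exec s) = o.operands s := by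
  cases o <;> simp only [inv, operands] <;>
    repeat rw [h.cell_exec (by intro i hi; simp [ptrs, hi])]

theorem writes_inv_exec (h : o.Admissible s) : o.inv.writes (o.exec s) = o.writes s := by
  cases o <;> simp only [inv, writes] <;>
    repeat rw [h.cell_exec (by intro i hi; simp [ptrs, hi])]

theorem keys_inv_exec (h : o.Admissible s) : o.inv.keys (o.exec s) = o.keys s := by
  cases o <;> simp only [inv, keys] <;>
    repeat rw [h.addr_exec (by simp [ptrs])]

theorem touched_inv_exec (h : o.Admissible s) : o.inv.touched (o.exec s) = o.touched s := by
  simp only [touched, ptrs_inv, operands_inv_exec h, keys_inv_exec h]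

/-- The operand addresses are the same after the operation, so the distinctness conditions carry
over. Only the bit negation and the key operations have promises about contents. -/
theorem promise_inv_exec (h : o.Admissible s) : o.inv.Promise (o.exec s) := by
  have hp := h.1
  cases o <;> simp only [inv, Promise] at hp ⊢ <;>
    (try rw [h.cell_exec (by intro i hi; simp [ptrs, hi])]) <;>
    (try rw [h.cell_exec (by intro i hi; simp [ptrs, hi])]) <;>
    (try rw [h.cell_exec (by intro i hi; simp [ptrs, hi])]) <;>
    (try assumption)
  case not a =>
    have ha := h.cell_exec (a := a) (by intro i hi; simp [ptrs, hi])
    rcases hp with hp | hp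
    · right; rw [State.val, ha]; simp [exec, State.write, hp]
    · left; rw [State.val, ha]; simp [exec, State.write, hp]
  case keyCopy p q =>
    refine ⟨hp.1, ?_⟩
    simp [exec, State.keyAt, State.addr, State.writeKey] at hp ⊢
    rw [Function.update_of_ne hp.1]
  case keyDestroyCopy p q =>
    refine ⟨hp.1, ?_⟩
    simp [exec, State.keyAt, State.addr, State.writeKey] 

theorem Admissible.inv_exec (h : o.Admissible s) : o.inv.Admissible (o.exec s) := by
  refine ⟨promise_inv_exec h, ?_⟩
  rw [ptrs_inv, writes_inv_exec h]
  exact h.2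

/-- Admissibility keeps every address variable fixed, so the inverse acts on the same cells, and the
promise keeps the source apart from the target, so that the amount added is still available for
subtraction. An erased copy is recovered from the original. -/
theorem exec_inv_exec (h : o.Admissible s) (hf : o.IsFree) : o.inv.exec (o.exec s) = s := by
  have hp := h.1
  have hc : ∀ a : Loc, (∀ i ∈ a.ptrs, i ∈ o.ptrs) → a.cell (o.exec s) = a.cell s :=
    fun a ha => h.cell_exec ha
  obtain ⟨si, sk⟩ := s
  cases o
  case add a b | sub a b =>
    have ha := hc a (by simp +contextual [ptrs])
    have hb := hc b (by simp +contextual [ptrs])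
    simp only [inv]
    simp only [exec, State.write, State.val] at ha hb ⊢
    rw [ha, hb]
    simp only [Promise] at hp
    simp [Function.update_of_ne hp.symm]
  case inc a | dec a | not a =>
    have ha := hc a (by simp +contextual [ptrs])
    simp only [inv]
    simp only [exec, State.write, State.val] at ha ⊢
    rw [ha]
    simp
  case swap a b =>
    have ha := hc a (by simp +contextual [ptrs])
    have hb := hc b (by simp +contextual [ptrs])
    simp only [inv]
    simp only [exec, State.val] at ha hb ⊢
    rw [ha, hb]
    congr 1
    funext c
    simp only [Function.update_apply]
    grind
  case le a b c | invLe a b c =>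
    have ha := hc a (by simp +contextual [ptrs])
    have hb := hc b (by simp +contextual [ptrs])
    have hcc := hc c (by simp +contextual [ptrs])
    simp only [inv]
    simp only [exec, State.write, State.val] at ha hb hcc ⊢
    rw [ha, hb, hcc]
    simp only [Promise] at hp
    simp [Function.update_of_ne hp.1, Function.update_of_ne hp.2]
  case keyCopy p q | keyDestroyCopy p q =>
    simp only [Promise, State.addr, State.keyAt] at hp
    simp only [inv, exec, State.writeKey, State.addr, State.keyAt]
    congr 1
    funext c
    simp only [Function.update_apply]
    grind
  case keySwap p q =>
    simp only [inv, exec, State.writeKey, State.addr, State.keyAt]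
    congr 1
    funext c
    simp only [Function.update_apply]
    grind
  case keyLe p q c | keyInvLe p q c =>
    have hcc := hc c (by simp +contextual [ptrs])
    have h1 := h.addr_exec (i := p) (by simp [ptrs])
    have h2 := h.addr_exec (i := q) (by simp [ptrs])
    simp only [inv]
    simp only [exec, State.write, State.val, State.keyAt] at h1 h2 hcc ⊢
    rw [hcc, h1, h2]
    simp
  all_goals exact hf.elim

end Op

/-! ### Reversibility of programs and composition of runs -/

namespace Program

/-- A program all of whose operations are free is reversible. -/
theorem reversible_of_isFree (P : Program)
    (h : ∀ o, Instr.op o ∈ P.code → o.IsFree) : P.Reversible := by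
  intro w x x' y hx hx'
  have hfree : ∀ {pc : ℕ} {o : Op}, P.code[pc]? = some (.op o) → o.IsFree := fun h' =>
    h _ (List.mem_of_getElem? h')
  cases hx with
  | @op pc s o h1 h2 h3 =>
    generalize hy : (⟨pc + 1, o.exec s⟩ : Config P.K w) = y at hx'
    cases hx' with
    | @op pc' s' o' h1' h2' h3' =>
      simp only [Config.mk.injEq, Nat.add_right_cancel_iff] at hy
      obtain ⟨rfl, hy⟩ := hy
      obtain rfl : o = o' := by simpa [h1] using h1'
      rw [← Op.exec_inv_exec h2 (hfree h1), hy, Op.exec_inv_exec h2' (hfree h1)]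
    | goto h1' h2' h3' h4' =>
      simp only [Config.mk.injEq] at hy
      obtain ⟨rfl, rfl⟩ := hy
      -- A fall-through and a jump cannot both reach the line: the condition of its `comefrom` would
      -- have to fail and to hold.
      exact absurd h4' (h3 _ _ h3')
    | noGoto h1' _ _ => simp_all
    | comefrom h1' _ => simp_all
  | @goto pc t s c c' h1 h2 h3 h4 =>
    generalize hy : (⟨t, s⟩ : Config P.K w) = y at hx'
    cases hx' with
    | op h1' h2' h3' =>
      simp only [Config.mk.injEq] at hy
      obtain ⟨rfl, rfl⟩ := hy
      exact absurd h4 (h3' _ _ h3)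
    -- Two jumps to one line come from the same place, since the `comefrom` there names a single
    -- source.
    | goto h1' h2' h3' h4' => simp_all
    | noGoto h1' h2' h3' =>
      simp only [Config.mk.injEq] at hy
      obtain ⟨rfl, rfl⟩ := hy
      exact absurd h4 (h3' _ _ h3)
    | comefrom h1' h3' =>
      simp only [Config.mk.injEq] at hy
      obtain ⟨rfl, rfl⟩ := hy
      exact absurd h4 (h3' _ _ h3)
  | @noGoto pc t s c h1 h2 h3 =>
    generalize hy : (⟨pc + 1, s⟩ : Config P.K w) = y at hx'
    cases hx' with
    | op h1' _ _ => simp_all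
    | goto h1' h2' h3' h4' =>
      simp only [Config.mk.injEq] at hy
      obtain ⟨rfl, rfl⟩ := hy
      exact absurd h4' (h3 _ _ h3')
    | noGoto h1' _ _ => simp_all
    | comefrom h1' _ => simp_all
  | @comefrom pc t s c h1 h3 =>
    generalize hy : (⟨pc + 1, s⟩ : Config P.K w) = y at hx'
    cases hx' with
    | op h1' _ _ => simp_all
    | goto h1' h2' h3' h4' =>
      simp only [Config.mk.injEq] at hy
      obtain ⟨rfl, rfl⟩ := hy
      exact absurd h4' (h3 _ _ h3')
    | noGoto h1' _ _ => simp_all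
    | comefrom h1' _ => simp_all

variable {w : ℕ} {P : Program}

theorem Run.trans {x y z : Config P.K w} {T E T' E' : ℕ} {A A' : Finset Cell}
    (h : P.Run x T E A y) (h' : P.Run y T' E' A' z) :
    P.Run x (T + T') (E + E') (A ∪ A') z := by
  induction h with
  | refl => simpa using h'
  | step hs _ ih =>
    have := Run.step hs (ih h')
    rwa [Nat.add_right_comm, Nat.add_assoc (P.energyAt _), Finset.union_assoc]

theorem Run.single {x y : Config P.K w} (h : P.Step x y) :
    P.Run x 1 (P.energyAt x) (P.touchedAt x) y := by
  simpa using Run.step h (Run.refl y)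

/-- A run does not change the cells that it does not access. -/
theorem Run.idx_eq_of_notMem {x y : Config P.K w} {T E : ℕ} {A : Finset Cell}
    (h : P.Run x T E A y) {c : ICell} (hc : Cell.idx c ∉ A) : y.state.idx c = x.state.idx c := by
  induction h with
  | refl => rfl
  | step hs _ ih =>
    simp only [Finset.mem_union, not_or] at hc
    rw [ih hc.2]
    cases hs with
    | op h1 h2 h3 =>
      apply Op.exec_idx_of_notMem_touched
      simpa [touchedAt, h1] using hc.1
    | goto => rfl
    | noGoto => rfl
    | comefrom => rfl

end Program

end EnergyRAM

/-! ### Structured programs and their inverses -/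

namespace EnergyRAM

/-- Structured programs.  `loop i r B` is entered with variable `i` zero and repeats `B` until
variable `r` is zero, where `i` is nonzero after each execution of `B`. -/
inductive Stmt where
  | op (o : Op)
  | seq (a b : Stmt)
  | loop (i r : ℕ) (B : Stmt)

/-- `Chain R s t s'`: a chain of `R`-steps from `s` to `s'`, of total time `t`. -/
inductive Chain {α : Type*} (R : α → ℕ → α → Prop) : α → ℕ → α → Prop
  | refl (s : α) : Chain R s 0 s
  | cons {s s₁ s' : α} {t t' : ℕ} : R s t s₁ → Chain R s₁ t' s' → Chain R s (t + t') s'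

namespace Chain

variable {α β : Type*} {R : α → ℕ → α → Prop}

theorem snoc {s s₁ s' : α} {t t' : ℕ} (h : Chain R s t s₁) (h' : R s₁ t' s') :
    Chain R s (t + t') s' := by
  induction h with
  | refl s => simpa using cons h' (refl _)
  | cons h1 _ ih =>
    rw [Nat.add_assoc]
    exact cons h1 (ih h')

theorem map {Q : β → ℕ → β → Prop} (f : α → β) (hf : ∀ s t s', R s t s' → Q (f s) t (f s'))
    {s s' : α} {t : ℕ} (h : Chain R s t s') : Chain Q (f s) t (f s') := by
  induction h with
  | refl s => exact refl _
  | cons h1 _ ih => exact cons (hf _ _ _ h1) ih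

theorem symm {Q : α → ℕ → α → Prop} (hQ : ∀ s t s', R s t s' → Q s' t s)
    {s s' : α} {t : ℕ} (h : Chain R s t s') : Chain Q s' t s := by
  induction h with
  | refl s => exact refl _
  | cons h1 _ ih =>
    rw [Nat.add_comm]
    exact ih.snoc (hQ _ _ _ h1)

/-- An invariant that advances `N` times yields a chain. -/
theorem exists_of_invariant {I : ℕ → α → Prop} {t N : ℕ}
    (step : ∀ k < N, ∀ s, I k s → ∃ s', R s t s' ∧ I (k + 1) s') {s : α} (h : I 0 s) :
    ∃ s', Chain R s (N * t) s' ∧ I N s' := by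
  induction N with
  | zero => exact ⟨s, by simpa using refl s, h⟩
  | succ N ih =>
    obtain ⟨s₁, hc, h1⟩ := ih fun k hk => step k (by omega)
    obtain ⟨s₂, hr, h2⟩ := step N (by omega) s₁ h1
    exact ⟨s₂, by rw [Nat.succ_mul]; exact hc.snoc hr, h2⟩

end Chain

namespace Stmt

/-- All operations are free. -/
def IsFree : Stmt → Prop
  | op o => o.IsFree
  | seq a b => a.IsFree ∧ b.IsFree
  | loop _ _ B => B.IsFree

/-- The inverse statement. -/
def inv : Stmt → Stmt
  | op o => op o.inv
  | seq a b => seq b.inv a.inv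
  | loop i r B => loop r i B.inv

theorem IsFree.inv {S : Stmt} (h : S.IsFree) : S.inv.IsFree := by
  induction S with
  | op o => exact Op.IsFree.inv h
  | seq a b iha ihb => exact ⟨ihb h.2, iha h.1⟩
  | loop i r B ih => exact ih h

/-- A sequence of operations. -/
def block : Op → List Op → Stmt
  | o, [] => op o
  | o, o' :: l => seq (op o) (block o' l)

/-- `S.Exec Reg s t s'`: the statement `S` goes from `s` to `s'` in `t` steps and accesses only
cells of `Reg`. -/
def Exec {K w : ℕ} (Reg : Set Cell) : Stmt → State K w → ℕ → State K w → Prop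
  | op o => fun s t s' => o.Admissible s ∧ (↑(o.touched s) ⊆ Reg) ∧ t = 1 ∧ s' = o.exec s
  | seq a b => fun s t s' => ∃ s₁ t₁ t₂, Exec Reg a s t₁ s₁ ∧ Exec Reg b s₁ t₂ s' ∧ t = t₁ + t₂
  | loop i r B => fun s t s' =>
      Cell.idx (.var i) ∈ Reg ∧ Cell.idx (.var r) ∈ Reg ∧ s.idx (.var i) = 0 ∧
      s'.idx (.var r) = 0 ∧
      ∃ t', t = t' + 3 ∧ Chain (fun s t s' => ∃ t', t = t' + 3 ∧
        s.idx (.var r) ≠ 0 ∧ Exec Reg B s t' s' ∧ s'.idx (.var i) ≠ 0) s t' s'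

variable {K w : ℕ} {Reg : Set Cell}

theorem Exec.mono {Reg' : Set Cell} (hR : Reg ⊆ Reg') {S : Stmt} {s s' : State K w} {t : ℕ}
    (h : S.Exec Reg s t s') : S.Exec Reg' s t s' := by
  induction S generalizing s s' t with
  | op o => exact ⟨h.1, h.2.1.trans hR, h.2.2⟩
  | seq a b iha ihb =>
    obtain ⟨s₁, t₁, t₂, h1, h2, rfl⟩ := h
    exact ⟨s₁, t₁, t₂, iha h1, ihb h2, rfl⟩
  | loop i r B ih =>
    obtain ⟨h1, h2, h3, h4, t', rfl, hc⟩ := h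
    refine ⟨hR h1, hR h2, h3, h4, t', rfl, hc.map id ?_⟩
    rintro s _ s' ⟨t', rfl, a, b, c⟩
    exact ⟨t', rfl, a, ih b, c⟩

/-- The inverse statement retraces the execution. -/
theorem Exec.inv {S : Stmt} (hf : S.IsFree) {s s' : State K w} {t : ℕ}
    (h : S.Exec Reg s t s') : S.inv.Exec Reg s' t s := by
  induction S generalizing s s' t with
  | op o =>
    obtain ⟨h1, h2, rfl, rfl⟩ := h
    refine ⟨h1.inv_exec, ?_, rfl, (Op.exec_inv_exec h1 hf).symm⟩
    rwa [Op.touched_inv_exec h1]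
  | seq a b iha ihb =>
    obtain ⟨s₁, t₁, t₂, h1, h2, rfl⟩ := h
    exact ⟨s₁, t₂, t₁, ihb hf.2 h2, iha hf.1 h1, Nat.add_comm _ _⟩
  | loop i r B ih =>
    obtain ⟨h1, h2, h3, h4, t', rfl, hc⟩ := h
    refine ⟨h2, h1, h4, h3, t', rfl, hc.symm ?_⟩
    rintro s _ s' ⟨t', rfl, a, b, c⟩
    exact ⟨t', rfl, c, ih hf b, a⟩

end Stmt

/-- Replace the key cells outside `Reg`. -/
noncomputable def State.replaceKeys {K w : ℕ} (Reg : Set Cell) (κ : ℕ → BitVec w)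
    (s : State K w) : State K w :=
  open Classical in { s with key := fun a => if Cell.key a ∈ Reg then s.key a else κ a }

/-! ### Independence of the keys outside the accessed region -/

section Replace

variable {K w : ℕ} {Reg : Set Cell} {κ : ℕ → BitVec w} {s : State K w}

theorem State.cell_replaceKeys (a : Loc) : a.cell (s.replaceKeys Reg κ) = a.cell s := by
  cases a <;> rfl

theorem State.val_replaceKeys (a : Loc) : (s.replaceKeys Reg κ).val a = s.val a := by
  cases a <;> rfl

theorem State.addr_replaceKeys (i : ℕ) : (s.replaceKeys Reg κ).addr i = s.addr i := rfl

theorem State.keyAt_replaceKeys {p : ℕ} (h : Cell.key (s.addr p) ∈ Reg) :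
    (s.replaceKeys Reg κ).keyAt p = s.keyAt p := by
  simp only [keyAt, addr_replaceKeys]
  exact if_pos h

theorem State.write_replaceKeys (a : Loc) (x : BitVec (K * w)) :
    (s.replaceKeys Reg κ).write a x = (s.write a x).replaceKeys Reg κ := by
  cases a <;> rfl

theorem State.writeKey_replaceKeys {p : ℕ} (h : Cell.key (s.addr p) ∈ Reg) (x : BitVec w) :
    (s.replaceKeys Reg κ).writeKey p x = (s.writeKey p x).replaceKeys Reg κ := by
  simp only [writeKey, addr_replaceKeys]
  simp only [replaceKeys]
  congr 1
  funext a
  simp only [Function.update_apply]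
  grind

theorem Op.touched_replaceKeys (o : Op) : o.touched (s.replaceKeys Reg κ) = o.touched s := by
  have h1 : o.operands (s.replaceKeys Reg κ) = o.operands s := by
    cases o <;> simp only [Op.operands, State.cell_replaceKeys]
  have h2 : o.keys (s.replaceKeys Reg κ) = o.keys s := by
    cases o <;> simp only [Op.keys, State.addr_replaceKeys]
  simp only [Op.touched, h1, h2]

theorem Op.keys_mem_of_touched_subset {o : Op} (h : ↑(o.touched s) ⊆ Reg) :
    ∀ a ∈ o.keys s, Cell.key a ∈ Reg := by
  intro a ha
  apply h
  simp [Op.touched, ha]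

theorem Op.exec_replaceKeys {o : Op} (h : ↑(o.touched s) ⊆ Reg) :
    o.exec (s.replaceKeys Reg κ) = (o.exec s).replaceKeys Reg κ := by
  have hk := Op.keys_mem_of_touched_subset h
  cases o <;> simp only [Op.keys, List.mem_cons, List.not_mem_nil, or_false, forall_eq_or_imp,
    forall_eq] at hk <;> simp only [Op.exec, State.val_replaceKeys, State.write_replaceKeys]
  case swap a b =>
    simp only [State.cell_replaceKeys]
    rfl
  case keyCopy p q | keySet p q =>
    rw [State.keyAt_replaceKeys hk.1, State.writeKey_replaceKeys hk.2]
  case keyDestroyCopy p q => rw [State.writeKey_replaceKeys hk.2]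
  case keySwap p q =>
    rw [State.keyAt_replaceKeys hk.1, State.keyAt_replaceKeys hk.2,
      State.writeKey_replaceKeys hk.1, State.writeKey_replaceKeys (by exact hk.2)]
  case keyLe p q c | keyInvLe p q c =>
    rw [State.keyAt_replaceKeys hk.1, State.keyAt_replaceKeys hk.2]

theorem Op.admissible_replaceKeys {o : Op} (h : ↑(o.touched s) ⊆ Reg) (ha : o.Admissible s) :
    o.Admissible (s.replaceKeys Reg κ) := by
  have hk := Op.keys_mem_of_touched_subset h
  refine ⟨?_, ?_⟩
  · have := ha.1
    cases o <;> simp only [Op.keys, List.mem_cons, List.not_mem_nil, or_false, forall_eq_or_imp,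
      forall_eq] at hk <;> simp only [Op.Promise, State.val_replaceKeys, State.cell_replaceKeys,
      State.addr_replaceKeys] at this ⊢ <;> try assumption
    case keyCopy p q => rwa [State.keyAt_replaceKeys hk.2]
    case keyDestroyCopy p q =>
      rwa [State.keyAt_replaceKeys hk.1, State.keyAt_replaceKeys hk.2]
  · have h1 : o.writes (s.replaceKeys Reg κ) = o.writes s := by
      cases o <;> simp only [Op.writes, State.cell_replaceKeys]
    rw [h1]
    exact ha.2

/-- An execution does not depend on the key cells outside its region. -/
theorem Stmt.Exec.replaceKeys (κ : ℕ → BitVec w) {S : Stmt} {s' : State K w} {t : ℕ}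
    (h : S.Exec Reg s t s') : S.Exec Reg (s.replaceKeys Reg κ) t (s'.replaceKeys Reg κ) := by
  induction S generalizing s s' t with
  | op o =>
    obtain ⟨h1, h2, rfl, rfl⟩ := h
    refine ⟨Op.admissible_replaceKeys h2 h1, ?_, rfl, (Op.exec_replaceKeys h2).symm⟩
    rwa [Op.touched_replaceKeys]
  | seq a b iha ihb =>
    obtain ⟨s₁, t₁, t₂, h1, h2, rfl⟩ := h
    exact ⟨_, t₁, t₂, iha h1, ihb h2, rfl⟩
  | loop i r B ih =>
    obtain ⟨h1, h2, h3, h4, t', rfl, hc⟩ := h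
    refine ⟨h1, h2, h3, h4, t', rfl, hc.map (State.replaceKeys Reg κ) ?_⟩
    rintro s _ s' ⟨t', rfl, a, b, c⟩
    exact ⟨t', rfl, a, ih b, c⟩

end Replace

/-! ### Compilation into paired jumps -/

namespace Stmt

/-- Number of lines of the compiled statement. -/
def size : Stmt → ℕ
  | op _ => 1
  | seq a b => a.size + b.size
  | loop _ _ B => B.size + 4

/-- The code of a statement that starts at line `l`. -/
def compile : Stmt → ℕ → List Instr
  | op o, _ => [.op o]
  | seq a b, l => a.compile l ++ b.compile (l + a.size)
  | loop i r B, l =>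
      .comefrom (.nonzero i) (l + 2 + B.size) :: .goto (.zero r) (l + 3 + B.size) ::
        (B.compile (l + 2) ++ [.goto .always l, .comefrom .always (l + 1)])

@[simp] theorem length_compile (S : Stmt) (l : ℕ) : (S.compile l).length = S.size := by
  induction S generalizing l with
  | op o => rfl
  | seq a b iha ihb => simp [compile, size, iha, ihb]
  | loop i r B ih => simp [compile, size, ih]

theorem IsFree.of_mem_compile {S : Stmt} (h : S.IsFree) {l : ℕ} {o : Op}
    (ho : Instr.op o ∈ S.compile l) : o.IsFree := by
  induction S generalizing l with
  | op o' =>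
    simp only [compile, List.mem_singleton, Instr.op.injEq] at ho
    exact ho ▸ h
  | seq a b iha ihb =>
    simp only [compile, List.mem_append] at ho
    exact ho.elim (iha h.1) (ihb h.2)
  | loop i r B ih =>
    simp only [compile, List.mem_cons, List.mem_append, reduceCtorEq, false_or, List.not_mem_nil,
      or_false] at ho
    exact ih h ho

/-- The code of `S` stands in `P` from line `l` on. -/
def At (P : Program) (S : Stmt) (l : ℕ) : Prop :=
  ∀ k < S.size, P.code[l + k]? = (S.compile l)[k]?

theorem At.seq_left {P : Program} {a b : Stmt} {l : ℕ} (h : At P (seq a b) l) : At P a l := by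
  intro k hk
  rw [h k (by simp only [size]; omega), compile, List.getElem?_append_left (by simpa using hk)]

theorem At.seq_right {P : Program} {a b : Stmt} {l : ℕ} (h : At P (seq a b) l) :
    At P b (l + a.size) := by
  intro k hk
  rw [Nat.add_assoc, h (a.size + k) (by simp only [size]; omega), compile,
    List.getElem?_append_right (by simp)]
  simp

theorem At.loop_body {P : Program} {i r : ℕ} {B : Stmt} {l : ℕ} (h : At P (loop i r B) l) :
    At P B (l + 2) := by
  intro k hk
  rw [Nat.add_assoc, h (2 + k) (by simp only [size]; omega), Nat.add_comm 2 k, compile,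
    List.getElem?_cons_succ, List.getElem?_cons_succ,
    List.getElem?_append_left (by simpa using hk)]

variable {P : Program} {w : ℕ} {Reg : Set Cell}

/-- The first line of a statement is an operation or the head of a loop. The `comefrom` at a loop
head asks whether the entry variable is nonzero, and an execution of the loop starts with that
variable zero. -/
theorem Exec.entersFromAbove {S : Stmt} {l t : ℕ} {s s' : State P.K w} (hS : At P S l)
    (h : S.Exec Reg s t s') : P.EntersFromAbove l s := by
  induction S generalizing l t s s' with
  | op o =>
    intro c src hc
    have := hS 0 (by simp [size])
    simp [compile, hc] at this
  | seq a b iha _ =>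
    obtain ⟨s₁, t₁, t₂, h1, h2, rfl⟩ := h
    exact iha hS.seq_left h1
  | loop i r B _ =>
    intro c src hc
    have := hS 0 (by simp [size])
    simp only [Nat.add_zero, hc, compile, List.getElem?_cons_zero, Option.some.injEq,
      Instr.comefrom.injEq] at this
    rw [this.1]
    exact fun h' => h' h.2.2.1

/-- The compiled code runs as the statement says. -/
theorem Exec.run {S : Stmt} (hf : S.IsFree) {l t : ℕ} {s s' : State P.K w} (hS : At P S l)
    (h : S.Exec Reg s t s') (he : P.EntersFromAbove (l + S.size) s') :
    ∃ A : Finset Cell, ↑A ⊆ Reg ∧ P.Run ⟨l, s⟩ t 0 A ⟨l + S.size, s'⟩ := by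
  induction S generalizing l t s s' with
  | op o =>
    obtain ⟨h1, h2, rfl, rfl⟩ := h
    have hc := hS 0 (by simp [size])
    simp only [Nat.add_zero, compile, List.getElem?_cons_zero] at hc
    have hr := Program.Run.single (Program.Step.op hc h1 he)
    have h3 : P.energyAt (⟨l, s⟩ : Config P.K w) = 0 := by
      simp [Program.energyAt, hc, Op.IsFree.energy_eq_zero hf]
    have h4 : P.touchedAt (⟨l, s⟩ : Config P.K w) = o.touched s := by
      simp [Program.touchedAt, hc]
    rw [h3, h4] at hr
    exact ⟨_, h2, hr⟩
  | seq a b iha ihb =>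
    obtain ⟨s₁, t₁, t₂, h1, h2, rfl⟩ := h
    obtain ⟨A, hA, hr⟩ := iha hf.1 hS.seq_left h1 (h2.entersFromAbove hS.seq_right)
    obtain ⟨A', hA', hr'⟩ := ihb hf.2 hS.seq_right h2 (by rwa [Nat.add_assoc])
    refine ⟨A ∪ A', by simp [hA, hA'], ?_⟩
    rw [Nat.add_assoc] at hr'
    exact hr.trans hr'
  | loop i r B ih =>
    obtain ⟨h1, h2, h3, h4, t', rfl, hc⟩ := h
    have c0 : P.code[l]? = some (.comefrom (.nonzero i) (l + 2 + B.size)) := by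
      simpa [compile] using hS 0 (by simp [size])
    have c1 : P.code[l + 1]? = some (.goto (.zero r) (l + 3 + B.size)) := by
      simpa [compile] using hS 1 (by simp [size])
    have c2 : P.code[l + 2 + B.size]? = some (.goto .always l) := by
      have := hS (B.size + 2) (by simp [size])
      rw [show l + (B.size + 2) = l + 2 + B.size by omega] at this
      simpa [compile, List.getElem?_append_right] using this
    have c3 : P.code[l + 3 + B.size]? = some (.comefrom .always (l + 1)) := by
      have := hS (B.size + 3) (by simp [size])
      rw [show l + (B.size + 3) = l + 3 + B.size by omega] at this
      simpa [compile, List.getElem?_append_right] using this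
    have ri : ∀ s : State P.K w, ∃ A : Finset Cell, ↑A ⊆ Reg ∧
        P.Run ⟨l, s⟩ 1 0 A ⟨l + 1, s⟩ := by
      intro s
      have := Program.Run.single (Program.Step.comefrom (s := s) c0
        (by intro c src hc'; simp [c1] at hc'))
      simp only [Program.energyAt, Program.touchedAt, c0] at this
      exact ⟨_, by simpa [Cond.touched] using h1, this⟩
    have loopRun : ∃ A : Finset Cell, ↑A ⊆ Reg ∧ P.Run ⟨l, s⟩ t' 0 A ⟨l, s'⟩ := by
      -- These conditions concern only the two ends of the chain and would spoil the induction over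
      -- its rounds.
      clear h3 h4 he
      induction hc with
      | refl s => exact ⟨∅, by simp, Program.Run.refl _⟩
      | @cons s s₁ s' t t' h5 _ ih' =>
        obtain ⟨u, rfl, h6, h7, h8⟩ := h5
        obtain ⟨A₁, hA₁, hr₁⟩ := ri s
        have hr₂ := Program.Run.single (Program.Step.noGoto (s := s) c1 (by simpa [Cond.Holds])
          (h7.entersFromAbove hS.loop_body))
        simp only [Program.energyAt, Program.touchedAt, c1] at hr₂
        obtain ⟨A₃, hA₃, hr₃⟩ := ih hf hS.loop_body h7
          (by intro c src hc'; simp [c2] at hc')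
        have hr₄ := Program.Run.single (Program.Step.goto (s := s₁) c2 trivial c0
          (by simpa [Cond.Holds]))
        simp only [Program.energyAt, Program.touchedAt, c2] at hr₄
        obtain ⟨A₅, hA₅, hr₅⟩ := ih'
        have hr := (((hr₁.trans hr₂).trans hr₃).trans hr₄).trans hr₅
        -- The three control steps of a round are the `comefrom` at the head, the exit test that
        -- fails, and the jump back.
        rw [show 1 + 1 + u + 1 + t' = u + 3 + t' by omega] at hr
        exact ⟨_, by simp [hA₁, hA₃, hA₅, Cond.touched, h2, Set.insert_subset_iff], hr⟩
    obtain ⟨A₁, hA₁, hr₁⟩ := loopRun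
    obtain ⟨A₂, hA₂, hr₂⟩ := ri s'
    have hr₃ := Program.Run.single (Program.Step.goto (s := s') c1 h4 c3 trivial)
    simp only [Program.energyAt, Program.touchedAt, c1] at hr₃
    have hr₄ := Program.Run.single (Program.Step.comefrom (s := s') c3
      (by rwa [show l + 3 + B.size + 1 = l + (B.size + 4) by omega]))
    simp only [Program.energyAt, Program.touchedAt, c3] at hr₄
    have hr := ((hr₁.trans hr₂).trans hr₃).trans hr₄
    rw [show t' + 1 + 1 + 1 = t' + 3 by omega,
      show l + 3 + B.size + 1 = l + (B.size + 4) by omega] at hr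
    exact ⟨_, by simp [hA₁, hA₂, Cond.touched, h2, Set.insert_subset_iff], hr⟩

end Stmt

end EnergyRAM

/-! ### Integer states and symbolic execution -/

namespace EnergyRAM

/-- Storage contents with integers instead of bit vectors in the index cells. -/
structure IState (w : ℕ) where
  vars : List ℤ
  mem : ℤ → ℤ
  key : ℕ → BitVec w

namespace IState

variable {w : ℕ}

/-- The value of a variable. -/
def get (σ : IState w) (i : ℕ) : ℤ := σ.vars.getD i 0

/-- The machine state that an integer state stands for. -/
def toState (K : ℕ) (σ : IState w) : State K w where
  idx
    | .var i => BitVec.ofInt (K * w) (σ.get i)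
    | .mem a => BitVec.ofInt (K * w) (σ.mem a)
  key := σ.key

/-- Assign a variable. -/
def setVar (σ : IState w) (i : ℕ) (x : ℤ) : IState w := { σ with vars := σ.vars.set i x }

/-- Assign a memory cell. -/
def setMem (σ : IState w) (a x : ℤ) : IState w := { σ with mem := Function.update σ.mem a x }

end IState

/-- The operations used below, on operands `var` or `mem[var]`. -/
inductive IOp where
  | add (a b : ℕ)
  | sub (a b : ℕ)
  | inc (a : ℕ)
  | dec (a : ℕ)
  /-- `a += mem[p]` -/
  | load (a p : ℕ)
  /-- `a -= mem[p]` -/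
  | unload (a p : ℕ)
  /-- `mem[p] += a` -/
  | store (p a : ℕ)
  /-- `mem[p] -= a` -/
  | unstore (p a : ℕ)
  /-- swap `a` and `mem[p]` -/
  | swap (a p : ℕ)
  /-- `c -= [a ≤ b]` -/
  | invLe (a b c : ℕ)
  /-- `c += [key at p ≤ key at q]` -/
  | keyLe (p q c : ℕ)
  | keyCopy (p q : ℕ)

namespace IOp

/-- The machine operation. -/
def toOp : IOp → Op
  | add a b => .add (.var a) (.var b)
  | sub a b => .sub (.var a) (.var b)
  | inc a => .inc (.var a)
  | dec a => .dec (.var a)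
  | load a p => .add (.var a) (.ptr p)
  | unload a p => .sub (.var a) (.ptr p)
  | store p a => .add (.ptr p) (.var a)
  | unstore p a => .sub (.ptr p) (.var a)
  | swap a p => .swap (.var a) (.ptr p)
  | invLe a b c => .invLe (.var a) (.var b) (.var c)
  | keyLe p q c => .keyLe p q (.var c)
  | keyCopy p q => .keyCopy p q

theorem isFree_toOp (o : IOp) : o.toOp.IsFree := by cases o <;> trivial

variable {w : ℕ}

/-- The effect on integer states. -/
def eval (σ : IState w) : IOp → IState w
  | add a b => σ.setVar a (σ.get a + σ.get b)
  | sub a b => σ.setVar a (σ.get a - σ.get b)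
  | inc a => σ.setVar a (σ.get a + 1)
  | dec a => σ.setVar a (σ.get a - 1)
  | load a p => σ.setVar a (σ.get a + σ.mem (σ.get p))
  | unload a p => σ.setVar a (σ.get a - σ.mem (σ.get p))
  | store p a => σ.setMem (σ.get p) (σ.mem (σ.get p) + σ.get a)
  | unstore p a => σ.setMem (σ.get p) (σ.mem (σ.get p) - σ.get a)
  | swap a p => (σ.setVar a (σ.mem (σ.get p))).setMem (σ.get p) (σ.get a)
  | invLe a b c => σ.setVar c (σ.get c - if σ.get a ≤ σ.get b then 1 else 0)
  | keyLe p q c =>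
      σ.setVar c (σ.get c + if σ.key (σ.get p).toNat ≤ σ.key (σ.get q).toNat then 1 else 0)
  | keyCopy p q =>
      { σ with key := Function.update σ.key (σ.get q).toNat (σ.key (σ.get p).toNat) }

/-- Conditions under which the effect of an operation is as described by `eval`; `B` bounds the
addresses and the compared numbers, and `Q` is the set of accessible key cells. -/
def Ok (B : ℤ) (Q : Set ℕ) (σ : IState w) : IOp → Prop
  | add a b | sub a b => (a < σ.vars.length ∧ b < σ.vars.length ∧ a ≠ b)
  | inc a | dec a => a < σ.vars.length
  | load a p | unload a p | store p a | unstore p a | swap a p =>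
      (a < σ.vars.length ∧ p < σ.vars.length ∧ a ≠ p) ∧ 0 ≤ σ.get p ∧ σ.get p < B
  | invLe a b c =>
      (a < σ.vars.length ∧ b < σ.vars.length ∧ c < σ.vars.length ∧ a ≠ c ∧ b ≠ c) ∧
      (0 ≤ σ.get a ∧ σ.get a < B) ∧ 0 ≤ σ.get b ∧ σ.get b < B
  | keyLe p q c =>
      (p < σ.vars.length ∧ q < σ.vars.length ∧ c < σ.vars.length ∧ p ≠ c ∧ q ≠ c) ∧
      (0 ≤ σ.get p ∧ σ.get p < B ∧ (σ.get p).toNat ∈ Q) ∧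
      0 ≤ σ.get q ∧ σ.get q < B ∧ (σ.get q).toNat ∈ Q
  | keyCopy p q =>
      (p < σ.vars.length ∧ q < σ.vars.length) ∧
      (0 ≤ σ.get p ∧ σ.get p < B ∧ (σ.get p).toNat ∈ Q) ∧
      (0 ≤ σ.get q ∧ σ.get q < B ∧ (σ.get q).toNat ∈ Q) ∧
      σ.get p ≠ σ.get q ∧ σ.key (σ.get q).toNat = 0

end IOp

/-- The first `V` variables, the memory cells below `B`, and the key cells in `Q`. -/
def region (V : ℕ) (B : ℤ) (Q : Set ℕ) : Set Cell
  | .idx (.var i) => i < V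
  | .idx (.mem a) => a < B
  | .key a => a ∈ Q

section

variable {K w : ℕ} {σ : IState w}

theorem toNat_ofInt_of_lt {k : ℕ} {x : ℤ} (h0 : 0 ≤ x) (h : x < 2 ^ k) :
    (BitVec.ofInt k x).toNat = x.toNat := by
  rw [BitVec.toNat_ofInt]
  congr 1
  exact Int.emod_eq_of_lt h0 (by exact_mod_cast h)

theorem ofInt_le_ofInt_iff {k : ℕ} {x y : ℤ} (h0 : 0 ≤ x) (h : x < 2 ^ k) (h0' : 0 ≤ y)
    (h' : y < 2 ^ k) : BitVec.ofInt k x ≤ BitVec.ofInt k y ↔ x ≤ y := by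
  rw [BitVec.le_def, toNat_ofInt_of_lt h0 h, toNat_ofInt_of_lt h0' h']
  omega

theorem ofInt_ne_zero {k : ℕ} {x : ℤ} (h0 : 0 < x) (h : x < 2 ^ k) :
    BitVec.ofInt k x ≠ 0 := by
  intro h1
  have := congrArg BitVec.toNat h1
  rw [toNat_ofInt_of_lt h0.le h] at this
  simp at this
  omega

theorem IState.get_setVar {i j : ℕ} {x : ℤ} (h : i < σ.vars.length) :
    (σ.setVar i x).get j = if j = i then x else σ.get j := by
  simp only [get, setVar, List.getD_eq_getElem?_getD, List.getElem?_set]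
  grind

theorem IState.addr_toState {B : ℤ} (hB : B ≤ 2 ^ (K * w)) {i : ℕ} (h0 : 0 ≤ σ.get i)
    (h : σ.get i < B) : (σ.toState K).addr i = (σ.get i).toNat :=
  toNat_ofInt_of_lt h0 (h.trans_le hB)

theorem IState.keyAt_toState {B : ℤ} (hB : B ≤ 2 ^ (K * w)) {i : ℕ} (h0 : 0 ≤ σ.get i)
    (h : σ.get i < B) : (σ.toState K).keyAt i = σ.key (σ.get i).toNat := by
  rw [State.keyAt, addr_toState hB h0 h]
  rfl

theorem IState.cell_ptr_toState {B : ℤ} (hB : B ≤ 2 ^ (K * w)) {i : ℕ} (h0 : 0 ≤ σ.get i)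
    (h : σ.get i < B) : (Loc.ptr i).cell (σ.toState K) = .mem (σ.get i).toNat := by
  simp only [Loc.cell, addr_toState hB h0 h]

theorem IState.toState_setVar {i : ℕ} (h : i < σ.vars.length) (x : ℤ) :
    (σ.setVar i x).toState K =
      (σ.toState K).write (.var i) (BitVec.ofInt _ x) := by
  simp only [State.write, toState, Loc.cell]
  congr 1
  funext c
  cases c with
  | var j =>
    rw [Function.update_apply]
    simp only [get_setVar h, ICell.var.injEq]
    split <;> rfl
  | mem a => rfl

theorem IState.toState_setMem {B : ℤ} (hB : B ≤ 2 ^ (K * w)) {i : ℕ} (h0 : 0 ≤ σ.get i)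
    (h : σ.get i < B) (x : ℤ) :
    (σ.setMem (σ.get i) x).toState K =
      (σ.toState K).write (.ptr i) (BitVec.ofInt _ x) := by
  simp only [State.write, cell_ptr_toState hB h0 h]
  simp only [toState]
  congr 1
  funext c
  cases c with
  | var j => rfl
  | mem a =>
    rw [Function.update_apply]
    simp only [setMem, Function.update_apply, ICell.mem.injEq]
    grind

theorem IState.val_var_toState (i : ℕ) :
    (σ.toState K).val (.var i) = BitVec.ofInt _ (σ.get i) := rfl

theorem IState.val_ptr_toState {B : ℤ} (hB : B ≤ 2 ^ (K * w)) {i : ℕ} (h0 : 0 ≤ σ.get i)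
    (h : σ.get i < B) :
    (σ.toState K).val (.ptr i) = BitVec.ofInt _ (σ.mem (σ.get i)) := by
  simp only [State.val, cell_ptr_toState hB h0 h]
  simp only [toState]
  rw [Int.toNat_of_nonneg h0]

theorem ofInt_sub_ofInt {k : ℕ} (x y : ℤ) :
    BitVec.ofInt k (x - y) = BitVec.ofInt k x - BitVec.ofInt k y := by
  rw [eq_sub_iff_add_eq, ← BitVec.ofInt_add, Int.sub_add_cancel]

theorem ofInt_one_eq {k : ℕ} : BitVec.ofInt k 1 = 1 := by
  apply BitVec.eq_of_toInt_eq
  simp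

/-- Reduction modulo `2 ^ (K * w)` respects addition and subtraction, so arithmetic needs no range
conditions and intermediate values may even be negative. Only addresses and compared index values
have to lie in `[0, B)`. -/
theorem IOp.exec_toOp {B : ℤ} (hB : B ≤ 2 ^ (K * w)) {Q : Set ℕ} {o : IOp} (h : o.Ok B Q σ) :
    o.toOp.exec (σ.toState K) = (o.eval σ).toState K := by
  cases o <;> simp only [Ok] at h
  case add a b | sub a b | inc a | dec a => 
    all_goals
      simp only [toOp, eval, Op.exec]
      rw [IState.toState_setVar (by simp only [h])]
      simp only [IState.val_var_toState, BitVec.ofInt_add, ofInt_sub_ofInt, ofInt_one_eq]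
  case load a p | unload a p =>
    all_goals
      simp only [toOp, eval, Op.exec]
      rw [IState.toState_setVar (by simp only [h]), IState.val_ptr_toState hB h.2.1 h.2.2]
      simp only [IState.val_var_toState, BitVec.ofInt_add, ofInt_sub_ofInt]
  case store p a | unstore p a =>
    all_goals
      simp only [toOp, eval, Op.exec]
      rw [IState.toState_setMem hB h.2.1 h.2.2, IState.val_ptr_toState hB h.2.1 h.2.2]
      simp only [IState.val_var_toState, BitVec.ofInt_add, ofInt_sub_ofInt]
  case swap a p =>
    simp only [toOp, eval, Op.exec]
    rw [IState.val_ptr_toState hB h.2.1 h.2.2, IState.cell_ptr_toState hB h.2.1 h.2.2]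
    have hs := congrArg State.idx (IState.toState_setVar (K := K) h.1.1 (σ.mem (σ.get p)))
    simp only [State.write] at hs
    rw [← hs, IState.val_var_toState]
    simp only [IState.toState]
    congr 1
    funext c
    cases c with
    | var j => rfl
    | mem d =>
      rw [Function.update_apply]
      simp only [IState.setMem, Function.update_apply, ICell.mem.injEq]
      grind
  case invLe a b c =>
    simp only [toOp, eval, Op.exec]
    rw [IState.toState_setVar h.1.2.2.1]
    simp only [IState.val_var_toState, ofInt_sub_ofInt, bit, ofInt_le_ofInt_iff h.2.1.1
      (h.2.1.2.trans_le hB) h.2.2.1 (h.2.2.2.trans_le hB)]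
    split <;> simp
  case keyLe p q c =>
    simp only [toOp, eval, Op.exec]
    rw [IState.toState_setVar h.1.2.2.1]
    rw [IState.keyAt_toState hB h.2.1.1 h.2.1.2.1, IState.keyAt_toState hB h.2.2.1 h.2.2.2.1]
    simp only [IState.val_var_toState, BitVec.ofInt_add, bit]
    split <;> simp
  case keyCopy p q =>
    simp only [toOp, eval, Op.exec, State.writeKey, State.keyAt,
      IState.addr_toState hB h.2.1.1 h.2.1.2.1, IState.addr_toState hB h.2.2.1.1 h.2.2.1.2.1]
    rfl

theorem IOp.admissible_toOp {B : ℤ} (hB : B ≤ 2 ^ (K * w)) {Q : Set ℕ} {o : IOp}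
    (h : o.Ok B Q σ) : o.toOp.Admissible (σ.toState K) := by
  cases o <;> simp only [Ok] at h <;>
    simp only [Op.Admissible, toOp, Op.Promise, Op.ptrs, Op.writes, Loc.ptrs]
  case load a p | unload a p | store p a | unstore p a | swap a p =>
    all_goals
      rw [IState.cell_ptr_toState hB h.2.1 h.2.2]
      simp [Loc.cell, h.1.2.2.symm]
  case keyCopy p q =>
    rw [State.keyAt, IState.addr_toState hB h.2.1.1 h.2.1.2.1,
      IState.addr_toState hB h.2.2.1.1 h.2.2.1.2.1]
    refine ⟨⟨by omega, h.2.2.2.2⟩, by simp⟩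
  all_goals simp [Loc.cell]
  all_goals grind

theorem IOp.touched_toOp {B : ℤ} (hB : B ≤ 2 ^ (K * w)) {Q : Set ℕ} {o : IOp} {V : ℕ}
    (hV : σ.vars.length ≤ V)
    (h : o.Ok B Q σ) : ↑(o.toOp.touched (σ.toState K)) ⊆ region V B Q := by
  have hV' : ∀ i, i < σ.vars.length → Cell.idx (.var i) ∈ region V B Q :=
    fun i hi => hi.trans_le hV
  have hM : ∀ p, 0 ≤ σ.get p ∧ σ.get p < B →
      Cell.idx ((Loc.ptr p).cell (σ.toState K)) ∈ region V B Q := by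
    intro p hp
    rw [IState.cell_ptr_toState hB hp.1 hp.2]
    show ((σ.get p).toNat : ℤ) < B
    omega
  have hQ : ∀ p, 0 ≤ σ.get p ∧ σ.get p < B ∧ (σ.get p).toNat ∈ Q →
      Cell.key ((σ.toState K).addr p) ∈ region V B Q := by
    intro p hp
    rw [IState.addr_toState hB hp.1 hp.2.1]
    exact hp.2.2
  cases o <;> simp only [Ok] at h <;>
    simp only [toOp, Op.touched, Op.ptrs, Op.operands, Op.keys, Loc.ptrs, List.map_cons,
      List.map_nil, List.nil_append, List.append_nil, List.toFinset_cons, List.toFinset_nil,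
      Finset.coe_union, Finset.coe_insert, Finset.coe_empty, Set.insert_subset_iff,
      Set.union_subset_iff, insert_empty_eq, Finset.coe_singleton,
      Set.singleton_subset_iff, Set.empty_subset] <;>
    and_intros <;>
    first
    | trivial
    | exact hV' _ (by tauto)
    | exact hM _ (by tauto)
    | exact hQ _ (by tauto)

/-- A block of operations. -/
def IOp.block (o : IOp) (l : List IOp) : Stmt := Stmt.block o.toOp (l.map IOp.toOp)

theorem IOp.isFree_block (o : IOp) (l : List IOp) : (IOp.block o l).IsFree := by
  induction l generalizing o with
  | nil => exact o.isFree_toOp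
  | cons o' l ih => exact ⟨o.isFree_toOp, ih o'⟩

/-- Weakest precondition of a list of operations. -/
def IOp.wp (B : ℤ) (Q : Set ℕ) : List IOp → (IState w → Prop) → IState w → Prop
  | [], R, σ => R σ
  | o :: l, R, σ => o.Ok B Q σ ∧ wp B Q l R (o.eval σ)

theorem IOp.wp_nil {B : ℤ} {Q : Set ℕ} {R : IState w → Prop} (h : R σ) : wp B Q [] R σ := h

theorem IOp.wp_cons {B : ℤ} {Q : Set ℕ} {o : IOp} {l : List IOp} {R : IState w → Prop}
    (h : o.Ok B Q σ) (h' : wp B Q l R (o.eval σ)) : wp B Q (o :: l) R σ :=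
  ⟨h, h'⟩

@[simp] theorem IOp.length_vars_eval (o : IOp) : (o.eval σ).vars.length = σ.vars.length := by
  cases o <;> simp [IOp.eval, IState.setVar, IState.setMem]

/-- `S.Yields K V B Q σ t R`: from `σ` the statement `S` takes `t` steps to a state with `R`,
inside `region V B Q`. -/
def Stmt.Yields (S : Stmt) (K V : ℕ) (B : ℤ) (Q : Set ℕ) (σ : IState w) (t : ℕ)
    (R : IState w → Prop) : Prop :=
  ∃ σ', S.Exec (region V B Q) (σ.toState K) t (σ'.toState K) ∧ R σ'

theorem IOp.yields_block {B : ℤ} (hB : B ≤ 2 ^ (K * w)) {Q : Set ℕ} {V : ℕ}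
    (hV : σ.vars.length ≤ V) {o : IOp} {l : List IOp} {R : IState w → Prop}
    (h : IOp.wp B Q (o :: l) R σ) :
    (IOp.block o l).Yields K V B Q σ (l.length + 1) R := by
  induction l generalizing o σ with
  | nil =>
    exact ⟨o.eval σ, ⟨IOp.admissible_toOp hB h.1, IOp.touched_toOp hB hV h.1, rfl,
      (IOp.exec_toOp hB h.1).symm⟩, h.2⟩
  | cons o' l ih =>
    obtain ⟨σ', he, hR⟩ := ih (σ := o.eval σ) (by simpa using hV) h.2
    refine ⟨σ', ⟨_, 1, _, ⟨IOp.admissible_toOp hB h.1, IOp.touched_toOp hB hV h.1, rfl,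
      (IOp.exec_toOp hB h.1).symm⟩, he, Nat.add_comm _ _⟩, hR⟩

theorem Stmt.Yields.seq {a b : Stmt} {V : ℕ} {B : ℤ} {Q : Set ℕ} {t₁ t₂ : ℕ}
    {R R' : IState w → Prop} (ha : a.Yields K V B Q σ t₁ R)
    (hb : ∀ σ', R σ' → b.Yields K V B Q σ' t₂ R') :
    (Stmt.seq a b).Yields K V B Q σ (t₁ + t₂) R' := by
  obtain ⟨σ₁, h1, h2⟩ := ha
  obtain ⟨σ₂, h3, h4⟩ := hb σ₁ h2
  exact ⟨σ₂, ⟨_, _, _, h1, h3, rfl⟩, h4⟩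

/-- Loops by an invariant `I k` for the state after `k` rounds. -/
theorem Stmt.Yields.loop {S : Stmt} {V : ℕ} {B : ℤ} {Q : Set ℕ} {t i r N : ℕ}
    (hB : B ≤ 2 ^ (K * w)) (hi : i < V) (hr : r < V) (hN : N < B) (I : ℕ → IState w → Prop)
    (h0 : I 0 σ) (hI : ∀ k ≤ N, ∀ σ, I k σ → σ.get i = k ∧
      (k < N → 0 < σ.get r ∧ σ.get r < B) ∧ (k = N → σ.get r = 0))
    (step : ∀ k < N, ∀ σ, I k σ → S.Yields K V B Q σ t (I (k + 1))) :
    (Stmt.loop i r S).Yields K V B Q σ (N * (t + 3) + 3) (I N) := by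
  let R : State K w → ℕ → State K w → Prop := fun s t s' => ∃ t', t = t' + 3 ∧
    s.idx (.var r) ≠ 0 ∧ S.Exec (region V B Q) s t' s' ∧ s'.idx (.var i) ≠ 0
  obtain ⟨s', hc, σ', rfl, hI'⟩ := Chain.exists_of_invariant (R := R) (t := t + 3) (N := N)
    (I := fun k s => ∃ σ : IState w, s = σ.toState K ∧ I k σ) (s := σ.toState K)
    (by
      rintro k hk _ ⟨σ, rfl, hσ⟩
      obtain ⟨σ', he, hσ'⟩ := step k hk σ hσ
      refine ⟨_, ⟨t, rfl, ?_, he, ?_⟩, σ', rfl, hσ'⟩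
      · have := (hI k hk.le σ hσ).2.1 hk
        exact ofInt_ne_zero this.1 (this.2.trans_le hB)
      -- The counter is `k + 1` with `1 ≤ k + 1 ≤ N < B`, so it does not wrap around to zero.
      · have := (hI (k + 1) hk σ' hσ').1
        exact ofInt_ne_zero (by omega) (by omega)) ⟨σ, rfl, h0⟩
  refine ⟨σ', ⟨hi, hr, ?_, ?_, _, rfl, hc⟩, hI'⟩
  · have := (hI 0 (Nat.zero_le _) σ h0).1
    simp [IState.toState, this]
  · have := (hI N le_rfl σ' hI').2.2 rfl
    simp [IState.toState, this]

end

end EnergyRAM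

/-! ### Heaps with a hole -/

namespace EnergyRAM

section Heap

/-- The depth is the position of the leading binary digit of the node number, and the offset is the
rest. -/
theorem node_injective {d e x y : ℕ} (hx : x < 2 ^ d) (hy : y < 2 ^ e)
    (h : 2 ^ d + x = 2 ^ e + y) : d = e ∧ x = y := by
  have hde : d = e := by
    rcases lt_trichotomy d e with hlt | heq | hlt
    · have := Nat.pow_le_pow_right (n := 2) (by norm_num) hlt
      rw [Nat.pow_succ] at this
      omega
    · exact heq
    · have := Nat.pow_le_pow_right (n := 2) (by norm_num) hlt
      rw [Nat.pow_succ] at this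
      omega
  subst hde
  exact ⟨rfl, by omega⟩

theorem exists_node {m u : ℕ} (h0 : 0 < u) (h : u < 2 ^ (m + 1)) :
    ∃ d ≤ m, ∃ x < 2 ^ d, u = 2 ^ d + x := by
  have h1 := Nat.pow_log_le_self 2 h0.ne'
  have h2 := Nat.lt_pow_succ_log_self (b := 2) (by norm_num) u
  refine ⟨Nat.log 2 u, ?_, u - 2 ^ Nat.log 2 u, ?_, by omega⟩
  · exact Nat.lt_succ_iff.1 (Nat.log_lt_of_lt_pow h0.ne' h)
  · rw [Nat.pow_succ] at h2
    omega

/-- A max-heap on the nodes `1, …, 2 ^ (m + 1) - 1` of a complete binary tree, where the node at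
depth `d` with offset `x < 2 ^ d` has the number `2 ^ d + x`, and its children, at depth `d + 1`,
the offsets `x` and `2 ^ d + x`. -/
def IsHeap (m : ℕ) (F : ℕ → ℕ) : Prop :=
  ∀ d < m, ∀ x < 2 ^ d, F (2 ^ (d + 1) + x) ≤ F (2 ^ d + x) ∧
    F (2 ^ (d + 1) + (2 ^ d + x)) ≤ F (2 ^ d + x)

/-- A heap except for the node at depth `d` with offset `x`. -/
structure IsHoleHeap (m : ℕ) (F : ℕ → ℕ) (d x : ℕ) : Prop where
  le : ∀ e < m, ∀ y < 2 ^ e, 2 ^ e + y ≠ 2 ^ d + x →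
    F (2 ^ (e + 1) + y) ≤ F (2 ^ e + y) ∧ F (2 ^ (e + 1) + (2 ^ e + y)) ≤ F (2 ^ e + y)
  le_parent : ∀ e, e + 1 = d → d < m → ∀ y < 2 ^ e, x = y ∨ x = 2 ^ e + y →
    F (2 ^ (d + 1) + x) ≤ F (2 ^ e + y) ∧ F (2 ^ (d + 1) + (2 ^ d + x)) ≤ F (2 ^ e + y)

theorem IsHeap.le_root {m : ℕ} {F : ℕ → ℕ} (h : IsHeap m F) {u : ℕ} (h0 : 0 < u)
    (hu : u < 2 ^ (m + 1)) : F u ≤ F 1 := by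
  obtain ⟨d, hd, x, hx, rfl⟩ := exists_node h0 hu
  clear h0 hu
  induction d generalizing x with
  | zero =>
    obtain rfl : x = 0 := by simpa using hx
    exact le_rfl
  | succ d ih =>
    rw [Nat.pow_succ] at hx
    by_cases hlt : x < 2 ^ d
    · exact (h d (by omega) x hlt).1.trans (ih (by omega) x hlt)
    -- At depth `d + 1` an offset of at least `2 ^ d` belongs to a second child, whose parent has
    -- offset `x - 2 ^ d`.
    · have h1 := (h d (by omega) (x - 2 ^ d) (by omega)).2
      rw [show 2 ^ d + (x - 2 ^ d) = x by omega] at h1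
      have h2 := ih (by omega) (x - 2 ^ d) (by omega)
      rw [show 2 ^ d + (x - 2 ^ d) = x by omega] at h2
      exact h1.trans h2

/-- Changing the root can only break the edges below it, and the root has no parent to compare its
children with. -/
theorem IsHeap.isHoleHeap {m : ℕ} {F F' : ℕ → ℕ} (h : IsHeap m F)
    (hF : ∀ u, 1 < u → F' u = F u) : IsHoleHeap m F' 0 0 := by
  refine ⟨fun e he y hy hne => ?_, fun e he => by omega⟩
  have h1 : 0 < 2 ^ e := by positivity
  have h2 := h e he y hy
  simp only [pow_zero] at hne
  rw [Nat.pow_succ] at h2 ⊢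
  rwa [hF _ (by omega), hF _ (by omega), hF _ (by omega)]

/-- A hole at a leaf has no children, so no edge is exempt. -/
theorem IsHoleHeap.isHeap {m x : ℕ} {F : ℕ → ℕ} (hx : x < 2 ^ m) (h : IsHoleHeap m F m x) :
    IsHeap m F := by
  intro d hd y hy
  refine h.le d hd y hy fun he => ?_
  have := (node_injective hy hx he).1
  omega

/-- Pulling up the larger child moves the hole down. -/
theorem IsHoleHeap.pull {m d x x' o : ℕ} {F F' : ℕ → ℕ} (h : IsHoleHeap m F d x) (hd : d < m)
    (hx : x < 2 ^ d) (hx' : x' = x ∧ o = 2 ^ d + x ∨ x' = 2 ^ d + x ∧ o = x)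
    (hle : F (2 ^ (d + 1) + o) ≤ F (2 ^ (d + 1) + x'))
    (h1 : F' (2 ^ d + x) = F (2 ^ (d + 1) + x')) (h2 : F' (2 ^ (d + 1) + x') = 0)
    (h3 : ∀ u, u ≠ 2 ^ d + x → u ≠ 2 ^ (d + 1) + x' → F' u = F u) :
    IsHoleHeap m F' (d + 1) x' := by
  have hp : 2 ^ (d + 1) = 2 * 2 ^ d := by rw [Nat.pow_succ, Nat.mul_comm]
  have hx'lt : x' < 2 ^ (d + 1) := by omega
  have hxlt : o < 2 ^ (d + 1) := by omega
  constructor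
  · intro e he y hy hne
    have hpe : 2 ^ (e + 1) = 2 * 2 ^ e := by rw [Nat.pow_succ, Nat.mul_comm]
    by_cases hv : 2 ^ e + y = 2 ^ d + x
    · obtain ⟨rfl, rfl⟩ := node_injective hy hx hv
      rw [h1]
      have ho : F' (2 ^ (e + 1) + o) ≤ F (2 ^ (e + 1) + x') := by
        rw [h3 _ (by omega) (by omega)]
        exact hle
      rcases hx' with ⟨rfl, rfl⟩ | ⟨rfl, rfl⟩
      · exact ⟨by rw [h2]; exact Nat.zero_le _, ho⟩
      · exact ⟨ho, by rw [h2]; exact Nat.zero_le _⟩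
    · rw [h3 _ hv hne]
      have key : ∀ y', (y' = y ∨ y' = 2 ^ e + y) → F' (2 ^ (e + 1) + y') ≤ F (2 ^ e + y) := by
        intro y' hy'
        have hy'lt : y' < 2 ^ (e + 1) := by omega
        -- The edge from above into the old hole is what `le_parent` was kept for.
        by_cases hk : 2 ^ (e + 1) + y' = 2 ^ d + x
        · obtain ⟨rfl, rfl⟩ := node_injective hy'lt hx hk
          rw [h1]
          have := h.le_parent e rfl hd y hy hy'
          rcases hx' with ⟨rfl, _⟩ | ⟨rfl, _⟩
          · exact this.1
          · exact this.2
        · rw [h3 _ hk]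
          · rcases hy' with rfl | rfl
            · exact (h.le e he y' hy hv).1
            · exact (h.le e he y hy hv).2
          · intro hk'
            obtain ⟨h4, h5⟩ := node_injective hy'lt hx'lt hk'
            obtain rfl : e = d := by omega
            omega
      exact ⟨key _ (Or.inl rfl), key _ (Or.inr rfl)⟩
  · intro e he hd' y hy hxy
    obtain rfl : e = d := by omega
    obtain rfl : y = x := by omega
    rw [h1]
    have hp2 : 2 ^ (e + 1 + 1) = 2 * 2 ^ (e + 1) := by rw [Nat.pow_succ, Nat.mul_comm]
    -- The children of the new hole were bounded by the value that has moved up, which is now in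
    -- their grandparent.
    have := h.le (e + 1) hd' x' hx'lt (by omega)
    rwa [h3 _ (by omega) (by omega), h3 _ (by omega) (by omega)]

end Heap

/-! ### Multisets of values and descending lists -/

section Multiset

variable {α β : Type*} [DecidableEq α]

theorem map_val_of_swap {s : Finset α} {f g : α → β} {a b : α} (ha : a ∈ s) (hb : b ∈ s)
    (h1 : g a = f b) (h2 : g b = f a) (h3 : ∀ u, u ≠ a → u ≠ b → g u = f u) :
    s.val.map g = s.val.map f := by
  have hg : g = f ∘ Equiv.swap a b := by
    funext u
    simp only [Function.comp_apply, Equiv.swap_apply_def]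
    split_ifs with h h'
    · rw [h, h1]
    · rw [h', h2]
    · exact h3 u h h'
  have hs : s.map (Equiv.swap a b).toEmbedding = s := by
    ext u
    simp only [Finset.mem_map_equiv, Equiv.symm_swap, Equiv.swap_apply_def]
    split_ifs with h h' <;> simp_all
  rw [hg, ← Multiset.map_map]
  congr 1
  exact congrArg Finset.val hs

/-- Stated with the exchanged values on opposite sides, which avoids subtraction of multisets. -/
theorem map_val_of_update {s : Finset α} {f g : α → β} {a : α} (ha : a ∈ s)
    (h : ∀ u ≠ a, g u = f u) : f a ::ₘ s.val.map g = g a ::ₘ s.val.map f := by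
  obtain ⟨t, hat, rfl⟩ : ∃ t, ∃ h : a ∉ t, s = t.cons a h :=
    ⟨s.erase a, by simp, by simp [ha]⟩
  have : t.val.map g = t.val.map f :=
    Multiset.map_congr rfl fun u hu => h u fun hua => hat (hua ▸ hu)
  simp only [Finset.cons_val, Multiset.map_cons, this]
  exact Multiset.cons_swap _ _ _

end Multiset

/-- The largest elements of a multiset that is padded with zeros. -/
theorem eq_replicate_append {O D : List ℕ} {S : Multiset ℕ} {p c mx : ℕ}
    (h : (O : Multiset ℕ) + S = ((List.replicate p mx ++ D : List ℕ) : Multiset ℕ) +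
      Multiset.replicate c 0)
    (hO : O.Pairwise (· ≥ ·)) (hS : ∀ o ∈ O, ∀ s ∈ S, s ≤ o) (hD : D.Pairwise (· ≥ ·))
    (hmx : ∀ x ∈ D, x ≤ mx) (hlen : O.length = p + D.length) :
    O = List.replicate p mx ++ D := by
  have hp : (O ++ S.sort (· ≥ ·)).Perm ((List.replicate p mx ++ D) ++ List.replicate c 0) := by
    rw [← Multiset.coe_eq_coe, ← Multiset.coe_add, ← Multiset.coe_add, Multiset.sort_eq, h]
    rfl
  have h1 : (O ++ S.sort (· ≥ ·)).Pairwise (· ≥ ·) := by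
    rw [List.pairwise_append]
    exact ⟨hO, Multiset.pairwise_sort _ _, fun a ha b hb => hS a ha b (by simpa using hb)⟩
  have h2 : ((List.replicate p mx ++ D) ++ List.replicate c 0).Pairwise (· ≥ ·) := by
    rw [List.pairwise_append, List.pairwise_append]
    refine ⟨⟨List.pairwise_replicate.2 (Or.inr le_rfl), hD, ?_⟩,
      List.pairwise_replicate.2 (Or.inr le_rfl), ?_⟩
    · intro a ha b hb
      rw [List.eq_of_mem_replicate ha]
      exact hmx b hb
    · intro a _ b hb
      rw [List.eq_of_mem_replicate hb]
      exact Nat.zero_le _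
  -- Both lists are descending arrangements of one multiset, hence equal; `O` and the claimed list
  -- are prefixes of the same length.
  have h3 := hp.eq_of_pairwise (fun a b _ _ h h' => le_antisymm h' h) h1 h2
  have h4 := congrArg (List.take O.length) h3
  rwa [List.take_left, hlen, List.take_left' (by simp)] at h4

end EnergyRAM

/-! ### The table of powers of two and the leaves of the tree -/

namespace EnergyRAM

open IOp

/-- The memory that holds the first powers of two. -/
def powMem (k : ℕ) (a : ℤ) : ℤ := if 0 ≤ a ∧ a ≤ k then 2 ^ a.toNat else 0

theorem powMem_natCast {k d : ℕ} (h : d ≤ k) : powMem k d = 2 ^ d := by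
  simp [powMem, h]

theorem powMem_of_lt {k : ℕ} {a : ℤ} (h : (k : ℤ) < a) : powMem k a = 0 := by
  simp only [powMem, ite_eq_right_iff]
  omega

theorem powMem_succ (k : ℕ) : powMem (k + 1) = Function.update (powMem k) (k + 1) (2 ^ (k + 1)) := by
  funext a
  simp only [powMem, Function.update_apply]
  rcases lt_trichotomy a (k + 1) with h | h | h
  · rw [if_neg h.ne]
    congr 1
    simp only [Nat.cast_add, Nat.cast_one, eq_iff_iff]
    omega
  · subst h
    rw [if_pos rfl, if_pos (by push_cast; omega)]
    congr 1
  · rw [if_neg (by push_cast; omega), if_neg h.ne', if_neg (by omega)]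

/-- The body of the loop that tabulates the powers of two. -/
def powBody : Stmt :=
  IOp.block (.load 4 1) [.inc 1, .store 1 4, .store 1 4, .dec 1, .unload 4 1, .inc 1, .load 4 1,
    .invLe 0 4 6, .unload 4 1]

/-- Tabulate the powers of two up to the first power `2 ^ m ≥ n` with `m ≥ 1`. -/
def powStmt : Stmt := .seq (IOp.block (.inc 4) [.store 1 4, .dec 4, .inc 6]) (.loop 1 6 powBody)

section

variable {K w n m : ℕ} {κ : ℕ → BitVec w} {Q : Set ℕ} {B : ℤ}

/-- Variable `6` is `1` until the comparison of `n` with the newest power lowers it to `0`. The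
comparison comes after a doubling, so at least one round is made; hence `1 ≤ m`. -/
theorem yields_powStmt (hB : B ≤ 2 ^ (K * w)) (hBm : 10 * 2 ^ m ≤ B) (hm : 1 ≤ m)
    (hn : n ≤ 2 ^ m) (hlt : ∀ k, 1 ≤ k → k < m → 2 ^ k < n) :
    powStmt.Yields K 17 B Q ⟨[n, 0, 0, 0, 0, 0, 0, 0, 0, 0, 0, 0, 0, 0, 0, 0, 0], 0, κ⟩
      (4 + (m * (10 + 3) + 3))
      (· = ⟨[n, m, 0, 0, 0, 0, 0, 0, 0, 0, 0, 0, 0, 0, 0, 0, 0], powMem m, κ⟩) := by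
  have hmP : (m : ℤ) < 2 ^ m := by exact_mod_cast Nat.lt_two_pow_self
  have hnP : (n : ℤ) ≤ 2 ^ m := by exact_mod_cast hn
  have hpow : (1 : ℤ) ≤ 2 ^ m := by exact_mod_cast Nat.one_le_two_pow
  refine Stmt.Yields.seq
    (R := (· = ⟨[n, 0, 0, 0, 0, 0, 1, 0, 0, 0, 0, 0, 0, 0, 0, 0, 0], powMem 0, κ⟩)) ?_ ?_
  · refine yields_block hB (by simp) ?_
    simp [wp, Ok, eval, IState.setVar, IState.setMem, IState.get]
    refine ⟨by omega, ?_⟩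
    funext a
    simp only [powMem, Function.update_apply, Pi.zero_apply, Nat.cast_zero]
    by_cases h : a = 0
    · simp [h]
    · rw [if_neg h, if_neg (by omega)]
  · rintro _ rfl
    have hloop := Stmt.Yields.loop (S := powBody) (V := 17) (Q := Q) (t := 10) (i := 1) (r := 6)
      (N := m) (σ := ⟨[n, 0, 0, 0, 0, 0, 1, 0, 0, 0, 0, 0, 0, 0, 0, 0, 0], powMem 0, κ⟩) hB
      (by norm_num) (by norm_num) (by omega)
      (fun k σ => σ = ⟨[n, k, 0, 0, 0, 0, if k < m then 1 else 0, 0, 0, 0, 0, 0, 0, 0, 0, 0, 0],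
        powMem k, κ⟩) (by simp; omega) ?_ ?_
    · simpa using hloop
    · rintro k hk _ rfl
      simp only [IState.get, List.getD_cons_succ, List.getD_cons_zero, true_and]
      exact ⟨fun h => by rw [if_pos h]; omega, fun h => if_neg (by omega)⟩
    · rintro k hk _ rfl
      refine yields_block hB (by simp) ?_
      have h1 : powMem k (k + 1) + powMem k k + powMem k k = 2 ^ (k + 1) := by
        rw [powMem_of_lt (by omega), powMem_natCast le_rfl]
        ring
      have h2 : (2 : ℤ) ^ (k + 1) ≤ 2 ^ m := by exact_mod_cast Nat.pow_le_pow_right (by norm_num) hk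
      have h3 : (0 : ℤ) < 2 ^ (k + 1) := by positivity
      simp [wp, Ok, eval, IState.setVar, IState.setMem, IState.get, h1, powMem_succ, hk]
      refine ⟨by omega, by omega, by omega, by omega, by omega, by omega, ?_⟩
      by_cases h : k + 1 < m
      · have : ¬ (n : ℤ) ≤ 2 ^ (k + 1) := by
          have := hlt (k + 1) (by omega) h
          exact_mod_cast this.not_ge
        simp [this, h]
      · obtain rfl : k + 1 = m := by omega
        simp [hnP]

/-- Set up the pointers. -/
def setupStmt : Stmt :=
  IOp.block (.load 2 1) [.add 3 0, .add 3 0, .add 8 2, .add 8 2, .add 7 2, .add 7 2, .add 7 2,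
    .add 6 0]

theorem yields_setupStmt (hB : B ≤ 2 ^ (K * w)) (hBm : 10 * 2 ^ m ≤ B) :
    setupStmt.Yields K 17 B Q ⟨[n, m, 0, 0, 0, 0, 0, 0, 0, 0, 0, 0, 0, 0, 0, 0, 0], powMem m, κ⟩ 9
      (· = ⟨[n, m, 2 ^ m, 2 * n, 0, 0, n, 3 * 2 ^ m, 2 * 2 ^ m, 0, 0, 0, 0, 0, 0, 0, 0],
        powMem m, κ⟩) := by
  have hmP : (m : ℤ) < 2 ^ m := by exact_mod_cast Nat.lt_two_pow_self
  refine yields_block hB (by simp) ?_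
  simp [wp, Ok, eval, IState.setVar, IState.get, powMem_natCast le_rfl]
  refine ⟨by omega, by ring, by ring, by ring⟩

/-- Enter the elements into the leaves and keep the number of a largest one. -/
def leafBody : Stmt :=
  IOp.block (.store 8 3) [.unstore 8 5, .inc 8,
    .swap 9 7, .add 11 3, .unload 11 7, .keyLe 11 5 10, .load 11 7, .sub 11 3,
    .inc 7, .store 7 3, .unstore 7 5, .dec 7,
    .add 7 10, .swap 9 7, .sub 7 10, .inc 7, .inc 7, .swap 10 7, .inc 7, .inc 5, .dec 6]

/-- The key cells that the sorting phase accesses. -/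
def inputCells (n : ℕ) : Set ℕ := {a | a < n ∨ a = 2 * n}

/-- Numbers of elements: `2 * n - a` stands for the key at address `a < n`, and `0` for the empty
key cell at address `2 * n`. -/
def IsId (n : ℕ) (g : ℤ) : Prop := g = 0 ∨ n < g ∧ g ≤ 2 * n

theorem IsId.mem_inputCells {g : ℤ} (h : IsId n g) : (2 * n - g).toNat ∈ inputCells n := by
  simp only [IsId, inputCells, Set.mem_ofPred_eq] at *
  omega

/-- The invariant of the loop with body `leafBody`. -/
structure LeafInv (n m : ℕ) (κ : ℕ → BitVec w) (k : ℕ) (g : ℤ) (M : ℤ → ℤ) : Prop where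
  pow : ∀ d : ℕ, d ≤ m → M d = 2 ^ d
  zero : ∀ a : ℤ, m < a → a < 2 * 2 ^ m → M a = 0
  leaf : ∀ j : ℕ, j < k → M (2 * 2 ^ m + j) = 2 * n - j
  zero' : ∀ a : ℤ, 2 * 2 ^ m + k ≤ a → a < 3 * 2 ^ m → M a = 0
  free : ∀ a : ℤ, 3 * 2 ^ m + 3 * k ≤ a → M a = 0
  isId : IsId n g
  max : ∀ j < k, (κ j).toNat ≤ (κ (2 * n - g).toNat).toNat

theorem LeafInv.step {k : ℕ} {g g' : ℤ} {M M' : ℤ → ℤ} (h : LeafInv n m κ k g M) (hk : k < n)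
    (hn : n ≤ 2 ^ m) (h1 : M' (2 * 2 ^ m + k) = 2 * n - k)
    (h2 : ∀ a : ℤ, a ≠ 2 * 2 ^ m + k → a < 3 * 2 ^ m ∨ 3 * 2 ^ m + 3 * k + 3 ≤ a → M' a = M a)
    (hg : IsId n g') (hmax : ∀ j ≤ k, (κ j).toNat ≤ (κ (2 * n - g').toNat).toNat) :
    LeafInv n m κ (k + 1) g' M' := by
  have hmP : (m : ℤ) < 2 ^ m := by exact_mod_cast Nat.lt_two_pow_self
  have hnP : (n : ℤ) ≤ 2 ^ m := by exact_mod_cast hn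
  refine ⟨fun d hd => ?_, fun a ha ha' => ?_, fun j hj => ?_, fun a ha ha' => ?_, fun a ha => ?_, hg,
    fun j hj => hmax j (by omega)⟩
  · rw [h2 _ (by omega) (by omega), h.pow d hd]
  · rw [h2 _ (by omega) (by omega), h.zero a ha ha']
  · rcases Nat.lt_succ_iff_lt_or_eq.1 hj with hj | rfl
    · rw [h2 _ (by omega) (by omega), h.leaf j hj]
    · exact h1
  · push_cast at ha
    rw [h2 _ (by omega) (by omega), h.zero' a (by omega) ha']
  · push_cast at ha
    rw [h2 _ (by omega) (by omega), h.free a (by omega)]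

/-- The maximum is updated without a branch: the old candidate and the new element are put into two
adjacent cells, and the comparison bit, added to the pointer, selects the cell to swap out. The
loser and the bit stay behind as history, which accounts for the three cells per element. -/
theorem yields_leafBody (hB : B ≤ 2 ^ (K * w)) (hBm : 10 * 2 ^ m ≤ B) (hn : n ≤ 2 ^ m) {k : ℕ}
    (hk : k < n) {g : ℤ} {M : ℤ → ℤ} (h : LeafInv n m κ k g M) :
    leafBody.Yields K 17 B (inputCells n)
      ⟨[n, m, 2 ^ m, 2 * n, 0, k, n - k, 3 * 2 ^ m + 3 * k, 2 * 2 ^ m + k, g,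
        0, 0, 0, 0, 0, 0, 0], M, κ⟩ 22
      fun σ => ∃ g M, LeafInv n m κ (k + 1) g M ∧
        σ = ⟨[n, m, 2 ^ m, 2 * n, 0, (k + 1 : ℕ), n - (k + 1 : ℕ), 3 * 2 ^ m + 3 * (k + 1 : ℕ),
          2 * 2 ^ m + (k + 1 : ℕ), g, 0, 0, 0, 0, 0, 0, 0], M, κ⟩ := by
  have hnP : (n : ℤ) ≤ 2 ^ m := by exact_mod_cast hn
  refine yields_block hB (by simp) ?_
  have step := fun g' M' => h.step (g' := g') (M' := M') hk hn
  obtain ⟨-, -, -, h4, h5, h6, h7⟩ := h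
  have h8 := h6.mem_inputCells
  have h9 : (k : ℤ).toNat ∈ inputCells n := Or.inl (by simpa using hk)
  have h10 : 0 ≤ 2 * (n : ℤ) - g ∧ 2 * (n : ℤ) - g < B := by
    simp only [IsId] at h6
    omega
  generalize (2 : ℤ) ^ m = P at *
  -- The leaf and the three history cells are still empty, so additions and swaps into them act as
  -- moves.
  have e1 := h4 (2 * P + k) le_rfl (by omega)
  have e2 := h5 (3 * P + 3 * k) le_rfl
  have e3 := h5 (3 * P + 3 * k + 1) (by omega)
  have e4 := h5 (3 * P + 3 * k + 1 + 1) (by omega)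
  clear h4 h5
  obtain ⟨b, hb, hcases⟩ : ∃ b : ℤ,
      (if κ (2 * n - g).toNat ≤ κ (k : ℤ).toNat then (1 : ℤ) else 0) = b ∧
      (b = 1 ∧ (κ (2 * n - g).toNat).toNat ≤ (κ k).toNat ∨
        b = 0 ∧ (κ k).toNat ≤ (κ (2 * n - g).toNat).toNat) := by
    refine ⟨_, rfl, ?_⟩
    rw [Int.toNat_natCast]
    split_ifs with hc
    · exact Or.inl ⟨rfl, hc⟩
    · exact Or.inr ⟨rfl, (not_le.1 hc).le⟩
  have hb' : 0 ≤ b ∧ b ≤ 1 := by omega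
  iterate 22
    refine wp_cons ?_ ?_
    · first
      | (simp [Ok, IState.get]; done)
      | (simp [Ok, IState.get]; omega)
      | (simp only [Ok, IState.get, List.getD_cons_succ, List.getD_cons_zero]
         exact ⟨by simp, ⟨h10.1, h10.2, h8⟩, by omega, by omega, h9⟩)
    simp (disch := omega) only [eval, IState.setVar, IState.setMem, IState.get,
      List.set_cons_succ, List.set_cons_zero, List.getD_cons_succ, List.getD_cons_zero, zero_add,
      add_sub_cancel_right, sub_self, sub_add_cancel, Function.update_self,
      Function.update_idem, Function.update_of_ne, hb, e1, e2, e3, e4]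
  apply wp_nil
  rw [show 3 * P + 3 * (k : ℤ) + 1 + 1 + 1 = 3 * P + 3 * (k + 1 : ℕ) by push_cast; ring,
    show 2 * P + (k : ℤ) + 1 = 2 * P + (k + 1 : ℕ) by push_cast; ring,
    show (n : ℤ) - k - 1 = n - (k + 1 : ℕ) by push_cast; ring]
  refine ⟨_, _, ?_, rfl⟩
  · apply step
    · simp (disch := omega) only [Function.update_self, Function.update_of_ne]
    · intro a h1 h2
      simp (disch := omega) only [Function.update_of_ne]
    · rcases hcases with ⟨rfl, hc⟩ | ⟨rfl, hc⟩
      · rw [Function.update_self]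
        exact Or.inr (by omega)
      · rw [Function.update_of_ne (by omega), add_zero, Function.update_self]
        exact h6
    · intro j hj
      rcases hcases with ⟨rfl, hc⟩ | ⟨rfl, hc⟩
      · rw [Function.update_self, show 2 * (n : ℤ) - (2 * n - k) = k by omega, Int.toNat_natCast]
        rcases hj.lt_or_eq with hj | rfl
        · exact (h7 j hj).trans hc
        · exact le_rfl
      · rw [Function.update_of_ne (by omega), add_zero, Function.update_self]
        rcases hj.lt_or_eq with hj | rfl
        · exact h7 j hj
        · exact hc

end

end EnergyRAM

/-! ### Filling the inner nodes, and one move of the hole -/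

namespace EnergyRAM

open IOp

section

variable {K w n m : ℕ} {κ : ℕ → BitVec w} {Q : Set ℕ} {B : ℤ}

theorem LeafInv.init : LeafInv n m κ 0 0 (powMem m) where
  pow d hd := powMem_natCast hd
  zero a ha _ := powMem_of_lt ha
  leaf j hj := by omega
  zero' a ha _ := by
    have hmP : (m : ℤ) < 2 ^ m := by exact_mod_cast Nat.lt_two_pow_self
    exact powMem_of_lt (by omega)
  free a ha := by
    have hmP : (m : ℤ) < 2 ^ m := by exact_mod_cast Nat.lt_two_pow_self
    exact powMem_of_lt (by omega)
  isId := Or.inl rfl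
  max j hj := by omega

theorem yields_leafLoop (hB : B ≤ 2 ^ (K * w)) (hBm : 10 * 2 ^ m ≤ B) (hn : n ≤ 2 ^ m) :
    (Stmt.loop 5 6 leafBody).Yields K 17 B (inputCells n)
      ⟨[n, m, 2 ^ m, 2 * n, 0, 0, n, 3 * 2 ^ m, 2 * 2 ^ m, 0, 0, 0, 0, 0, 0, 0, 0], powMem m, κ⟩
      (n * (22 + 3) + 3)
      fun σ => ∃ g M, LeafInv n m κ n g M ∧
        σ = ⟨[n, m, 2 ^ m, 2 * n, 0, n, 0, 3 * 2 ^ m + 3 * n, 2 * 2 ^ m + n, g,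
          0, 0, 0, 0, 0, 0, 0], M, κ⟩ := by
  have hnP : (n : ℤ) ≤ 2 ^ m := by exact_mod_cast hn
  have hpow : (1 : ℤ) ≤ 2 ^ m := by exact_mod_cast Nat.one_le_two_pow
  have := Stmt.Yields.loop (S := leafBody) (V := 17) (Q := inputCells n) (t := 22) (i := 5) (r := 6)
    (N := n) (σ := ⟨[n, m, 2 ^ m, 2 * n, 0, 0, n, 3 * 2 ^ m, 2 * 2 ^ m, 0, 0, 0, 0, 0, 0, 0, 0],
      powMem m, κ⟩) hB (by norm_num) (by norm_num) (by omega)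
    (fun k σ => ∃ g M, LeafInv n m κ k g M ∧
        σ = ⟨[n, m, 2 ^ m, 2 * n, 0, k, n - k, 3 * 2 ^ m + 3 * k, 2 * 2 ^ m + k, g,
          0, 0, 0, 0, 0, 0, 0], M, κ⟩) ⟨0, powMem m, LeafInv.init, by simp⟩ ?_ ?_
  · simpa using this
  · rintro k hk _ ⟨g, M, _, rfl⟩
    simp only [IState.get, List.getD_cons_succ, List.getD_cons_zero, true_and]
    omega
  · rintro k hk _ ⟨g, M, h, rfl⟩
    exact yields_leafBody hB hBm hn hk h

/-- Fill an inner node of the tree. -/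
def fillBody : Stmt := IOp.block (.store 8 9) [.inc 8, .inc 5, .dec 6]

/-- The memory after filling `k` cells. -/
def fillMem (m k : ℕ) (g : ℤ) (M : ℤ → ℤ) (a : ℤ) : ℤ :=
  if 2 ^ m ≤ a ∧ a < 2 ^ m + k then g else M a

/-- Fill the inner nodes of the tree by a largest element. -/
def fillStmt : Stmt :=
  .seq (IOp.block (.sub 5 0) [.sub 8 0, .sub 8 2, .add 6 2]) (.seq (.loop 5 6 fillBody)
    (IOp.block (.sub 5 2) [.sub 8 2, .sub 8 2, .add 6 2, .dec 6, .add 6 0, .add 15 1]))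

/-- There are `2 ^ m - 1` inner nodes, but `2 ^ m` cells are filled, so that the available number `2
^ m` serves as counter; the cell at address `2 ^ m`, just before the root, belongs to no node. The
last block prepares `2 ^ m - 1 + n` extractions. -/
theorem yields_fillStmt (hB : B ≤ 2 ^ (K * w)) (hBm : 10 * 2 ^ m ≤ B) {g : ℤ} {M : ℤ → ℤ}
    (h : LeafInv n m κ n g M) :
    fillStmt.Yields K 17 B Q
      ⟨[n, m, 2 ^ m, 2 * n, 0, n, 0, 3 * 2 ^ m + 3 * n, 2 * 2 ^ m + n, g, 0, 0, 0, 0, 0, 0, 0],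
        M, κ⟩ (4 + ((2 ^ m * (4 + 3) + 3) + 7))
      (· = ⟨[n, m, 2 ^ m, 2 * n, 0, 0, 2 ^ m - 1 + n, 3 * 2 ^ m + 3 * n, 0, g, 0, 0, 0, 0, 0, m, 0],
        fillMem m (2 ^ m) g M, κ⟩) := by
  have hmP : (m : ℤ) < 2 ^ m := by exact_mod_cast Nat.lt_two_pow_self
  refine Stmt.Yields.seq (R := (· = ⟨[n, m, 2 ^ m, 2 * n, 0, 0, 2 ^ m, 3 * 2 ^ m + 3 * n, 2 ^ m, g,
    0, 0, 0, 0, 0, 0, 0], M, κ⟩)) ?_ ?_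
  · refine yields_block hB (by simp) ?_
    simp [wp, Ok, eval, IState.setVar, IState.get]
    ring
  rintro _ rfl
  refine Stmt.Yields.seq (R := (· = ⟨[n, m, 2 ^ m, 2 * n, 0, 2 ^ m, 0, 3 * 2 ^ m + 3 * n,
    2 ^ m + 2 ^ m, g, 0, 0, 0, 0, 0, 0, 0], fillMem m (2 ^ m) g M, κ⟩)) ?_ ?_
  · have := Stmt.Yields.loop (S := fillBody) (V := 17) (Q := Q) (t := 4) (i := 5) (r := 6)
      (N := 2 ^ m) (σ := ⟨[n, m, 2 ^ m, 2 * n, 0, 0, 2 ^ m, 3 * 2 ^ m + 3 * n, 2 ^ m, g,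
        0, 0, 0, 0, 0, 0, 0], M, κ⟩) hB (by norm_num) (by norm_num) (by push_cast; omega)
      (fun k σ => σ = ⟨[n, m, 2 ^ m, 2 * n, 0, k, 2 ^ m - k, 3 * 2 ^ m + 3 * n, 2 ^ m + k, g,
        0, 0, 0, 0, 0, 0, 0], fillMem m k g M, κ⟩) ?_ ?_ ?_
    · simpa using this
    · have : fillMem m 0 g M = M := by
        funext a
        simp only [fillMem, Nat.cast_zero, add_zero]
        rw [if_neg (by omega)]
      simp [this]
    · rintro k hk _ rfl
      simp only [IState.get, List.getD_cons_succ, List.getD_cons_zero, true_and]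
      have : (k : ℤ) ≤ 2 ^ m := by exact_mod_cast hk
      refine ⟨fun h => ?_, fun h => ?_⟩
      · have : (k : ℤ) < 2 ^ m := by exact_mod_cast h
        omega
      · rw [h]
        simp
    · rintro k hk _ rfl
      have hk' : (k : ℤ) < 2 ^ m := by exact_mod_cast hk
      refine yields_block hB (by simp) ?_
      have h0 : fillMem m k g M (2 ^ m + k) = 0 := by
        rw [fillMem, if_neg (by omega), h.zero _ (by omega) (by omega)]
      have h1 : Function.update (fillMem m k g M) (2 ^ m + k) g = fillMem m (k + 1) g M := by
        funext a
        rw [Function.update_apply]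
        simp only [fillMem, Nat.cast_add, Nat.cast_one]
        generalize (2 : ℤ) ^ m = P at *
        split_ifs <;> first | rfl | omega
      simp [wp, Ok, eval, IState.setVar, IState.setMem, IState.get, h0, h1]
      refine ⟨by omega, by ring, by ring⟩
  rintro _ rfl
  refine yields_block hB (by simp) ?_
  simp [wp, Ok, eval, IState.setVar, IState.get]

/-- The value of the key that a number stands for. -/
def idVal (n : ℕ) (κ : ℕ → BitVec w) (g : ℤ) : ℕ := (κ (2 * n - g).toNat).toNat

/-- Move the hole at address `13` to the larger child. -/
def pullBody : Stmt :=
  IOp.block (.add 8 14) [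
    .load 13 8, .add 11 3, .unload 11 13, .unload 13 8,
    .inc 8, .load 13 8, .add 12 3, .unload 12 13, .unload 13 8, .dec 8,
    .keyLe 11 12 10,
    .load 13 8, .sub 11 3, .load 11 13, .unload 13 8,
    .inc 8, .load 13 8, .sub 12 3, .load 12 13, .unload 13 8, .dec 8,
    .add 8 10, .load 13 8, .swap 4 13, .unload 13 8, .swap 4 13, .load 13 8, .sub 8 10,
    .load 16 8, .inc 8, .load 16 8, .add 16 2, .invLe 16 13 10,
    .sub 16 2, .unload 16 8, .dec 8, .unload 16 8, .sub 8 14, .inc 14, .dec 15]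

/-- With `p = 2 ^ d`, the children of the hole lie `p` and `2 * p` cells behind it, and both
distances are entries of the table of powers, at `d` and `d + 1`. The comparison bit `b` selects the
entry `d + b`. Afterwards it is erased by a comparison of addresses, so a move leaves no history
apart from the position of the hole. -/
theorem yields_pullBody (hB : B ≤ 2 ^ (K * w)) {P p d x e : ℤ} {M : ℤ → ℤ} (hBm : 10 * P ≤ B)
    (hn : n ≤ P) (hd : 0 ≤ d) (hdP : d + 1 < P) (hp : 0 < p) (hpP : 2 * p ≤ P) (h0 : M d = p)
    (h1 : M (d + 1) = 2 * p) (hx : 0 ≤ x ∧ x < p) (hM : M (P + p + x) = 0)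
    (hl : IsId n (M (P + p + x + p))) (hr : IsId n (M (P + p + x + 2 * p))) (i r A g : ℤ) :
    pullBody.Yields K 17 B (inputCells n)
      ⟨[n, m, P, 2 * n, 0, i, r, A, 0, g, 0, 0, 0, P + p + x, d, e, 0], M, κ⟩ 41
      fun σ => ∃ b : ℤ,
        (b = 1 ∧ idVal n κ (M (P + p + x + p)) ≤ idVal n κ (M (P + p + x + 2 * p)) ∨
          b = 0 ∧ idVal n κ (M (P + p + x + 2 * p)) ≤ idVal n κ (M (P + p + x + p))) ∧
        σ = ⟨[n, m, P, 2 * n, 0, i, r, A, 0, g, 0, 0, 0, P + p + x + (1 + b) * p, d + 1, e - 1, 0],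
          Function.update (Function.update M (P + p + x + (1 + b) * p) 0) (P + p + x)
            (M (P + p + x + (1 + b) * p)), κ⟩ := by
  refine yields_block hB (by simp) ?_
  have hl' := hl.mem_inputCells
  have hr' := hr.mem_inputCells
  have hlB : 0 ≤ 2 * (n : ℤ) - M (P + p + x + p) ∧ 2 * (n : ℤ) - M (P + p + x + p) < B := by
    simp only [IsId] at hl
    omega
  have hrB : 0 ≤ 2 * (n : ℤ) - M (P + p + x + 2 * p) ∧
      2 * (n : ℤ) - M (P + p + x + 2 * p) < B := by
    simp only [IsId] at hr
    omega
  obtain ⟨b, hb, hcases⟩ : ∃ b : ℤ,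
      (if κ (2 * n - M (P + p + x + p)).toNat ≤ κ (2 * n - M (P + p + x + 2 * p)).toNat
        then (1 : ℤ) else 0) = b ∧
      (b = 1 ∧ idVal n κ (M (P + p + x + p)) ≤ idVal n κ (M (P + p + x + 2 * p)) ∨
          b = 0 ∧ idVal n κ (M (P + p + x + 2 * p)) ≤ idVal n κ (M (P + p + x + p))) := by
    refine ⟨_, rfl, ?_⟩
    split_ifs with hc
    · exact Or.inl ⟨rfl, hc⟩
    · exact Or.inr ⟨rfl, (not_le.1 hc).le⟩
  have hb' : 0 ≤ b ∧ b ≤ 1 := by omega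
  obtain ⟨s, hs⟩ : ∃ s, s = (1 + b) * p := ⟨_, rfl⟩
  have hs' : p ≤ s ∧ s ≤ 2 * p := by
    rcases hcases with ⟨rfl, _⟩ | ⟨rfl, _⟩ <;> omega
  -- The table entry that the bit selects is the distance to the larger child.
  have hq : M (d + b) = s := by
    rcases hcases with ⟨rfl, _⟩ | ⟨rfl, _⟩
    · rw [h1, hs]; ring
    · rw [add_zero, h0, hs]; ring
  -- As `0 ≤ x < p`, the new address reaches `P + 3 * p` exactly if the second child was chosen;
  -- this recomputes `b`.
  have hy : (if p + 2 * p + P ≤ P + p + x + s then (1 : ℤ) else 0) = b := by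
    rcases hcases with ⟨rfl, _⟩ | ⟨rfl, _⟩
    · rw [if_pos (by omega)]
    · rw [if_neg (by omega)]
  iterate 41
    refine wp_cons ?_ ?_
    · first
      | (simp [Ok, IState.get]; done)
      | (simp [Ok, IState.get]; omega)
      | (simp only [Ok, IState.get, List.getD_cons_succ, List.getD_cons_zero]
         exact ⟨by simp, ⟨hlB.1, hlB.2, hl'⟩, hrB.1, hrB.2, hr'⟩)
    simp (disch := omega) only [eval, IState.setVar, IState.setMem, IState.get,
      List.set_cons_succ, List.set_cons_zero, List.getD_cons_succ, List.getD_cons_zero, zero_add,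
      add_sub_cancel_right, sub_self, Function.update_of_ne, hb, h0, h1, hM, hq, hy,
      sub_sub_cancel_left, neg_add_cancel]
  apply wp_nil
  refine ⟨b, hcases, ?_⟩
  rw [← hs]

end

end EnergyRAM

/-! ### The descent of the hole to a leaf -/

namespace EnergyRAM

open IOp

section

variable {K w n m : ℕ} {κ : ℕ → BitVec w} {Q : Set ℕ} {B : ℤ}

/-- The values in the tree. -/
noncomputable def treeVals (n m : ℕ) (κ : ℕ → BitVec w) (M : ℤ → ℤ) : Multiset ℕ :=
  (Finset.Ioo (2 ^ m : ℤ) (3 * 2 ^ m)).val.map fun a => idVal n κ (M a)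

/-- The memory while the hole is at depth `d` with offset `x`; `M₁` is the memory before the hole
started to move. -/
structure HoleInv (n m : ℕ) (κ : ℕ → BitVec w) (M₁ : ℤ → ℤ) (d x : ℕ) (M : ℤ → ℤ) : Prop where
  lt : x < 2 ^ d
  frame : ∀ a : ℤ, a ≤ 2 ^ m ∨ 3 * 2 ^ m ≤ a → M a = M₁ a
  isId : ∀ a : ℤ, 2 ^ m < a → a < 3 * 2 ^ m → IsId n (M a)
  hole : M (2 ^ m + 2 ^ d + x) = 0
  heap : IsHoleHeap m (fun u => idVal n κ (M (2 ^ m + u))) d x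
  tree : treeVals n m κ M = treeVals n m κ M₁

/-- A move exchanges the hole with its larger child. The multiset of values is therefore unchanged,
and the heap condition is `IsHoleHeap.pull`, where the number `0` of the hole has value `0` because
the key cell at `2 * n` is empty. -/
theorem HoleInv.step {M₁ M : ℤ → ℤ} {d x : ℕ} (h : HoleInv n m κ M₁ d x M) (hκ : κ (2 * n) = 0)
    (hd : d < m) {b : ℕ}
    (hb : b = 1 ∧ idVal n κ (M (2 ^ m + 2 ^ d + x + 2 ^ d)) ≤
        idVal n κ (M (2 ^ m + 2 ^ d + x + 2 * 2 ^ d)) ∨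
      b = 0 ∧ idVal n κ (M (2 ^ m + 2 ^ d + x + 2 * 2 ^ d)) ≤
        idVal n κ (M (2 ^ m + 2 ^ d + x + 2 ^ d))) :
    HoleInv n m κ M₁ (d + 1) (x + b * 2 ^ d)
      (Function.update (Function.update M (2 ^ m + 2 ^ d + x + (1 + b) * 2 ^ d) 0)
        (2 ^ m + 2 ^ d + x) (M (2 ^ m + 2 ^ d + x + (1 + b) * 2 ^ d))) := by
  have hlt := h.lt
  have hp : 2 * 2 ^ d ≤ 2 ^ m := by
    rw [Nat.mul_comm, ← Nat.pow_succ]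
    exact Nat.pow_le_pow_right (by norm_num) hd
  have hp0 : 0 < 2 ^ d := by positivity
  have hpz : (2 : ℤ) * 2 ^ d ≤ 2 ^ m := by exact_mod_cast hp
  have hp0z : (0 : ℤ) < 2 ^ d := by positivity
  have hltz : (x : ℤ) < 2 ^ d := by exact_mod_cast hlt
  obtain ⟨c, hc⟩ : ∃ c : ℕ, c = b * 2 ^ d := ⟨_, rfl⟩
  have hc' : b = 1 ∧ c = 2 ^ d ∨ b = 0 ∧ c = 0 := by
    rcases hb with ⟨rfl, _⟩ | ⟨rfl, _⟩ <;> simp [hc]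
  have hcz : (c : ℤ) ≤ 2 ^ d := by
    rcases hc' with ⟨_, rfl⟩ | ⟨_, rfl⟩
    · simp
    · simp
  have hchild : (2 : ℤ) ^ m + 2 ^ d + x + (1 + b) * 2 ^ d = 2 ^ m + (2 ^ (d + 1) + x + c) := by
    rw [hc]; push_cast; ring
  rw [hchild, ← hc]
  have h2z : (2 : ℤ) ^ (d + 1) = 2 * 2 ^ d := by ring
  have h2 : 2 ^ (d + 1) = 2 * 2 ^ d := by ring
  have hid0 : idVal n κ 0 = 0 := by
    have : (2 * (n : ℤ) - 0).toNat = 2 * n := by omega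
    rw [idVal, this, hκ]
    rfl
  set M' := Function.update (Function.update M (2 ^ m + (2 ^ (d + 1) + x + c)) 0)
    (2 ^ m + 2 ^ d + x) (M (2 ^ m + (2 ^ (d + 1) + x + c))) with hM'
  have e1 : M' (2 ^ m + 2 ^ d + x) = M (2 ^ m + (2 ^ (d + 1) + x + c)) := by simp [hM']
  have e2 : M' (2 ^ m + (2 ^ (d + 1) + x + c)) = 0 := by
    rw [hM', Function.update_of_ne (by omega), Function.update_self]
  have e3 : ∀ a : ℤ, a ≠ 2 ^ m + 2 ^ d + x → a ≠ 2 ^ m + (2 ^ (d + 1) + x + c) → M' a = M a := by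
    intro a h1 h2
    rw [hM', Function.update_of_ne h1, Function.update_of_ne h2]
  clear_value M'
  refine ⟨by omega, fun a ha => ?_, fun a ha ha' => ?_, ?_, ?_, ?_⟩
  · rw [e3 a (by omega) (by omega), h.frame a ha]
  · by_cases h1 : a = 2 ^ m + 2 ^ d + x
    · rw [h1, e1]
      exact h.isId _ (by omega) (by omega)
    · by_cases h2 : a = 2 ^ m + (2 ^ (d + 1) + x + c)
      · rw [h2, e2]
        exact Or.inl rfl
      · rw [e3 a h1 h2]
        exact h.isId a ha ha'
  · rw [← e2]
    congr 1
    push_cast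
    ring
  -- Since `c` is `0` or `2 ^ d`, the child that is not chosen has offset `x + (2 ^ d - c)`.
  · refine h.heap.pull (o := x + (2 ^ d - c)) hd hlt ?_ ?_ ?_ ?_ ?_
    · omega
    · rcases hb with ⟨rfl, hb⟩ | ⟨rfl, hb⟩
      · obtain rfl : c = 2 ^ d := by omega
        convert hb using 3
        · push_cast
          rw [Nat.sub_self, Nat.cast_zero]
          ring
        · push_cast
          ring
      · obtain rfl : c = 0 := by omega
        convert hb using 3
        · push_cast
          rw [Nat.sub_zero]
          push_cast
          ring
        · push_cast
          ring
    · congr 1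
      convert e1 using 2
      · push_cast
        ring
      · push_cast
        ring
    · rw [← hid0, ← e2]
      congr 2
      push_cast
      ring
    · intro u h3 h4
      have h3' : (u : ℤ) ≠ 2 ^ d + x := by exact_mod_cast h3
      have h4' : (u : ℤ) ≠ 2 ^ (d + 1) + (x + c) := by exact_mod_cast h4
      rw [e3 _ (by omega) (by omega)]
  · rw [← h.tree]
    refine map_val_of_swap (a := 2 ^ m + 2 ^ d + (x : ℤ)) (b := 2 ^ m + (2 ^ (d + 1) + x + c))
      (by rw [Finset.mem_Ioo]; omega) (by rw [Finset.mem_Ioo]; omega) ?_ ?_ ?_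
    · rw [e1]
    · rw [e2, h.hole]
    · intro u h3 h4
      rw [e3 u h3 h4]

/-- The descent never stops early, even below a hole with only empty nodes: a fixed number of rounds
makes the final position alone sufficient for the way back. -/
theorem yields_pullLoop (hB : B ≤ 2 ^ (K * w)) (hBm : 10 * 2 ^ m ≤ B) (hn : n ≤ 2 ^ m)
    (hκ : κ (2 * n) = 0) {M₁ : ℤ → ℤ} (hpow : ∀ d : ℕ, d ≤ m → M₁ d = 2 ^ d)
    (h0 : HoleInv n m κ M₁ 0 0 M₁) (i r A g : ℤ) :
    (Stmt.loop 14 15 pullBody).Yields K 17 B (inputCells n)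
      ⟨[n, m, 2 ^ m, 2 * n, 0, i, r, A, 0, g, 0, 0, 0, 2 ^ m + 1, 0, m, 0], M₁, κ⟩
      (m * (41 + 3) + 3)
      fun σ => ∃ (x : ℕ) (M : ℤ → ℤ), HoleInv n m κ M₁ m x M ∧
        σ = ⟨[n, m, 2 ^ m, 2 * n, 0, i, r, A, 0, g, 0, 0, 0, 2 ^ m + 2 ^ m + x, m, 0, 0], M, κ⟩ := by
  have hmP : (m : ℤ) < 2 ^ m := by exact_mod_cast Nat.lt_two_pow_self
  have hnP : (n : ℤ) ≤ 2 ^ m := by exact_mod_cast hn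
  have := Stmt.Yields.loop (S := pullBody) (V := 17) (Q := inputCells n) (t := 41) (i := 14)
    (r := 15) (N := m)
    (σ := ⟨[n, m, 2 ^ m, 2 * n, 0, i, r, A, 0, g, 0, 0, 0, 2 ^ m + 1, 0, m, 0], M₁, κ⟩) hB
    (by norm_num) (by norm_num) (by omega)
    (fun d σ => ∃ (x : ℕ) (M : ℤ → ℤ), HoleInv n m κ M₁ d x M ∧
        σ = ⟨[n, m, 2 ^ m, 2 * n, 0, i, r, A, 0, g, 0, 0, 0, 2 ^ m + 2 ^ d + x, d, m - d, 0], M, κ⟩)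
    ⟨0, M₁, h0, by simp⟩ ?_ ?_
  · simpa using this
  · rintro d hd _ ⟨x, M, _, rfl⟩
    simp only [IState.get, List.getD_cons_succ, List.getD_cons_zero, true_and]
    omega
  · rintro d hd _ ⟨x, M, h, rfl⟩
    have hp : (2 : ℤ) * 2 ^ d ≤ 2 ^ m := by
      have : 2 * 2 ^ d ≤ 2 ^ m := by
        rw [Nat.mul_comm, ← Nat.pow_succ]
        exact Nat.pow_le_pow_right (by norm_num) hd
      exact_mod_cast this
    have hp0 : (0 : ℤ) < 2 ^ d := by positivity
    have hlt : (x : ℤ) < 2 ^ d := by exact_mod_cast h.lt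
    have hb := yields_pullBody (m := m) (κ := κ) hB (P := 2 ^ m) (p := 2 ^ d) (d := d) (x := x)
      (e := m - d) (M := M) hBm hnP (by omega) (by omega) hp0 hp
      (by rw [h.frame _ (by omega), hpow d hd.le])
      (by
        rw [h.frame _ (by omega)]
        have := hpow (d + 1) hd
        push_cast at this
        rw [this]
        ring)
      ⟨by omega, hlt⟩ h.hole (h.isId _ (by omega) (by omega)) (h.isId _ (by omega) (by omega))
      i r A g
    obtain ⟨_, he, b, hcases, rfl⟩ := hb
    obtain ⟨b, rfl⟩ : ∃ b' : ℕ, b = b' := ⟨b.toNat, by omega⟩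
    refine ⟨_, he, x + b * 2 ^ d, _, h.step hκ hd (by exact_mod_cast hcases), ?_⟩
    rw [show (2 : ℤ) ^ m + 2 ^ d + x + (1 + b) * 2 ^ d =
        2 ^ m + 2 ^ (d + 1) + (x + b * 2 ^ d : ℕ) by push_cast; ring,
      show (m : ℤ) - d - 1 = m - (d + 1 : ℕ) by push_cast; ring,
      show (d : ℤ) + 1 = (d + 1 : ℕ) by push_cast; ring]

end

end EnergyRAM

/-! ### Extracting the elements in descending order -/

namespace EnergyRAM

open IOp

section

variable {K w n m : ℕ} {κ : ℕ → BitVec w} {B : ℤ}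

theorem idVal_zero (hκ : κ (2 * n) = 0) : idVal n κ 0 = 0 := by
  have : (2 * (n : ℤ) - 0).toNat = 2 * n := by omega
  rw [idVal, this, hκ]
  rfl

/-- Remove the root of the tree and record it, together with the leaf that becomes empty. -/
def extractBody : Stmt :=
  .seq (IOp.block (.add 13 2) [.inc 13, .swap 4 13, .swap 4 7, .inc 7])
    (.seq (.loop 14 15 pullBody)
      (IOp.block (.add 15 14) [.sub 14 15, .swap 13 7, .inc 7, .inc 5, .dec 6]))

/-- The memory after `j` extractions: `O` lists the extracted values, and `T` are the values at the
start. -/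
structure ExtractInv (n m : ℕ) (κ : ℕ → BitVec w) (T : Multiset ℕ) (j : ℕ) (O : List ℕ)
    (M : ℤ → ℤ) : Prop where
  pow : ∀ d : ℕ, d ≤ m → M d = 2 ^ d
  isId : ∀ a : ℤ, 2 ^ m < a → a < 3 * 2 ^ m → IsId n (M a)
  heap : IsHeap m (fun u => idVal n κ (M (2 ^ m + u)))
  vals : (O : Multiset ℕ) + treeVals n m κ M = T + Multiset.replicate j 0
  sorted : O.Pairwise (· ≥ ·)
  le : ∀ o ∈ O, ∀ s ∈ treeVals n m κ M, s ≤ o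
  length : O.length = j
  out : ∀ i : ℕ, i < j → IsId n (M (3 * 2 ^ m + 3 * n + 2 * i)) ∧
    O[i]? = some (idVal n κ (M (3 * 2 ^ m + 3 * n + 2 * i)))
  hole : ∀ i : ℕ, i < j → 0 < M (3 * 2 ^ m + 3 * n + 2 * i + 1) ∧
    M (3 * 2 ^ m + 3 * n + 2 * i + 1) < 3 * 2 ^ m
  free : ∀ a : ℤ, 3 * 2 ^ m + 3 * n + 2 * j ≤ a → M a = 0

/-- The memory after removing the root. -/
def rootOut (n m j : ℕ) (M : ℤ → ℤ) : ℤ → ℤ :=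
  Function.update (Function.update M (2 ^ m + 1) 0) (3 * 2 ^ m + 3 * n + 2 * j) (M (2 ^ m + 1))

section

variable {T : Multiset ℕ} {j : ℕ} {O : List ℕ} {M : ℤ → ℤ}

theorem rootOut_root : rootOut n m j M (2 ^ m + 1) = 0 := by
  have hpow : (1 : ℤ) ≤ 2 ^ m := by exact_mod_cast Nat.one_le_two_pow
  rw [rootOut, Function.update_of_ne (by omega), Function.update_self]

theorem rootOut_of_ne {a : ℤ} (h : a ≠ 2 ^ m + 1) (h' : a < 3 * 2 ^ m + 3 * n + 2 * j) :
    rootOut n m j M a = M a := by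
  rw [rootOut, Function.update_of_ne (by omega), Function.update_of_ne h]

theorem ExtractInv.holeInv (h : ExtractInv n m κ T j O M) :
    HoleInv n m κ (rootOut n m j M) 0 0 (rootOut n m j M) := by
  have hpow : (1 : ℤ) ≤ 2 ^ m := by exact_mod_cast Nat.one_le_two_pow
  refine ⟨by simp, fun a _ => rfl, fun a ha ha' => ?_, ?_, ?_, rfl⟩
  · by_cases h1 : a = 2 ^ m + 1
    · rw [h1, rootOut_root]
      exact Or.inl rfl
    · rw [rootOut_of_ne h1 (by omega)]
      exact h.isId a ha ha'
  · simpa using rootOut_root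
  -- Removing the root also writes a history cell outside the tree. Cutting the values off beyond
  -- the tree leaves the root as the only change, as `IsHeap.isHoleHeap` requires.
  · have hF : IsHeap m (fun u => if u < 2 ^ (m + 1) then idVal n κ (M (2 ^ m + u)) else 0) := by
      intro d hd x hx
      have h1 : 2 ^ (d + 1) ≤ 2 ^ m := Nat.pow_le_pow_right (by norm_num) hd
      have h2 : 2 ^ (d + 1) = 2 * 2 ^ d := by ring
      have h3 : 2 ^ (m + 1) = 2 * 2 ^ m := by ring
      simp only
      rw [if_pos (by omega), if_pos (by omega), if_pos (by omega)]
      exact h.heap d hd x hx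
    have hH := hF.isHoleHeap
      (F' := fun u => if u < 2 ^ (m + 1) then idVal n κ (rootOut n m j M (2 ^ m + u)) else 0) ?_
    · refine ⟨fun e he y hy hne => ?_, fun e he => by omega⟩
      have h1 : 2 ^ (e + 1) ≤ 2 ^ m := Nat.pow_le_pow_right (by norm_num) he
      have h2 : 2 ^ (e + 1) = 2 * 2 ^ e := by ring
      have h3 : 2 ^ (m + 1) = 2 * 2 ^ m := by ring
      have := hH.le e he y hy hne
      rwa [if_pos (by omega), if_pos (by omega), if_pos (by omega)] at this
    · intro u hu
      split_ifs with h4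
      · have : (u : ℤ) < 2 * 2 ^ m := by
          have h3 : 2 ^ (m + 1) = 2 * 2 ^ m := by ring
          rw [h3] at h4
          exact_mod_cast h4
        rw [rootOut_of_ne (by omega) (by omega)]
      · rfl

theorem ExtractInv.le_root (h : ExtractInv n m κ T j O M) {s : ℕ} (hs : s ∈ treeVals n m κ M) :
    s ≤ idVal n κ (M (2 ^ m + 1)) := by
  simp only [treeVals, Multiset.mem_map, Finset.mem_val, Finset.mem_Ioo] at hs
  obtain ⟨a, ⟨ha, ha'⟩, rfl⟩ := hs
  obtain ⟨u, rfl⟩ : ∃ u : ℕ, a = 2 ^ m + u := ⟨(a - 2 ^ m).toNat, by omega⟩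
  have h1 : (u : ℤ) < 2 ^ (m + 1) := by rw [pow_succ]; omega
  have := h.heap.le_root (u := u) (by omega) (by exact_mod_cast h1)
  simpa using this

theorem ExtractInv.root_mem :
    idVal n κ (M (2 ^ m + 1)) ∈ treeVals n m κ M := by
  have hpow : (1 : ℤ) ≤ 2 ^ m := by exact_mod_cast Nat.one_le_two_pow
  exact Multiset.mem_map.2 ⟨2 ^ m + 1, by simp only [Finset.mem_val, Finset.mem_Ioo]; omega, rfl⟩

/-- The root is a largest value of the tree and was bounded by all earlier outputs, so appending it
keeps the list descending. The values left are old ones and a zero, hence bounded by every output.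
-/
theorem ExtractInv.step (hκ : κ (2 * n) = 0) (h : ExtractInv n m κ T j O M) {x : ℕ}
    {M₂ : ℤ → ℤ} (h2 : HoleInv n m κ (rootOut n m j M) m x M₂) :
    ExtractInv n m κ T (j + 1) (O ++ [idVal n κ (M (2 ^ m + 1))])
      (Function.update M₂ (3 * 2 ^ m + 3 * n + 2 * j + 1) (2 ^ m + 2 ^ m + x)) := by
  have hpow : (1 : ℤ) ≤ 2 ^ m := by exact_mod_cast Nat.one_le_two_pow
  have hmP : (m : ℤ) < 2 ^ m := by exact_mod_cast Nat.lt_two_pow_self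
  have hx : (x : ℤ) < 2 ^ m := by exact_mod_cast h2.lt
  have hself : (Function.update M₂ (3 * 2 ^ m + 3 * n + 2 * j + 1) (2 ^ m + 2 ^ m + x))
      (3 * 2 ^ m + 3 * n + 2 * j + 1) = 2 ^ m + 2 ^ m + (x : ℤ) := Function.update_self ..
  have hne : ∀ a : ℤ, a ≠ 3 * 2 ^ m + 3 * n + 2 * j + 1 →
      (Function.update M₂ (3 * 2 ^ m + 3 * n + 2 * j + 1) (2 ^ m + 2 ^ m + x)) a = M₂ a :=
    fun a ha => Function.update_of_ne ha ..
  generalize Function.update M₂ (3 * 2 ^ m + 3 * n + 2 * j + 1) (2 ^ m + 2 ^ m + x) = M₃ at *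
  have hold : ∀ a : ℤ, a ≤ 2 ^ m ∨ 3 * 2 ^ m ≤ a ∧ a < 3 * 2 ^ m + 3 * n + 2 * j → M₃ a = M a := by
    intro a ha
    rw [hne a (by omega), h2.frame a (by omega), rootOut_of_ne (by omega) (by omega)]
  have hnew : M₃ (3 * 2 ^ m + 3 * n + 2 * j) = M (2 ^ m + 1) := by
    rw [hne _ (by omega), h2.frame _ (by omega), rootOut, Function.update_self]
  have htree : treeVals n m κ M₃ = treeVals n m κ (rootOut n m j M) := by
    rw [← h2.tree]
    refine Multiset.map_congr rfl fun a ha => ?_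
    simp only [Finset.mem_val, Finset.mem_Ioo] at ha
    rw [hne a (by omega)]
  -- The descent only permutes the tree, so the net effect is to trade the root value for a zero.
  have hcons : idVal n κ (M (2 ^ m + 1)) ::ₘ treeVals n m κ M₃ = 0 ::ₘ treeVals n m κ M := by
    have := map_val_of_update (s := Finset.Ioo (2 ^ m : ℤ) (3 * 2 ^ m)) (a := 2 ^ m + 1)
      (f := fun a => idVal n κ (M a))
      (g := fun a => idVal n κ (Function.update M (2 ^ m + 1) 0 a))
      (by rw [Finset.mem_Ioo]; omega)
      (fun u hu => by rw [Function.update_of_ne hu])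
    simp only [Function.update_self, idVal_zero hκ] at this
    rw [htree]
    refine Eq.trans ?_ this
    congr 1
    refine Multiset.map_congr rfl fun a ha => ?_
    simp only [Finset.mem_val, Finset.mem_Ioo] at ha
    rw [rootOut, Function.update_of_ne (by omega)]
  have hmem : ∀ s ∈ treeVals n m κ M₃, s = 0 ∨ s ∈ treeVals n m κ M := by
    intro s hs
    rw [← Multiset.mem_cons, ← hcons]
    exact Multiset.mem_cons_of_mem hs
  refine ⟨fun d hd => ?_, fun a ha ha' => ?_, ?_, ?_, ?_, ?_, by simp [h.length], ?_, ?_, ?_⟩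
  · rw [hold d (by omega), h.pow d hd]
  · rw [hne a (by omega)]
    exact h2.isId a ha ha'
  · intro d hd y hy
    have h3 : 2 ^ (d + 1) ≤ 2 ^ m := Nat.pow_le_pow_right (by norm_num) hd
    have h4 : 2 ^ (d + 1) = 2 * 2 ^ d := by ring
    have hz : ∀ u : ℕ, u < 2 * 2 ^ m → M₃ (2 ^ m + u) = M₂ (2 ^ m + u) := by
      intro u hu
      have : (u : ℤ) < 2 * 2 ^ m := by exact_mod_cast hu
      exact hne _ (by omega)
    simp only
    rw [hz _ (by omega), hz _ (by omega), hz _ (by omega)]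
    exact h2.heap.isHeap h2.lt d hd y hy
  · rw [← Multiset.coe_add, Multiset.coe_singleton, add_assoc, Multiset.singleton_add, hcons,
      Multiset.replicate_succ, Multiset.add_cons, Multiset.add_cons, h.vals]
  · rw [List.pairwise_append]
    refine ⟨h.sorted, List.pairwise_singleton _ _, fun a ha b hb => ?_⟩
    rw [List.mem_singleton.1 hb]
    exact h.le a ha _ ExtractInv.root_mem
  · intro o ho s hs
    rcases hmem s hs with rfl | hs
    · exact Nat.zero_le _
    · rcases List.mem_append.1 ho with ho | ho
      · exact h.le o ho s hs
      · rw [List.mem_singleton.1 ho]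
        exact h.le_root hs
  · intro i hi
    rcases Nat.lt_succ_iff_lt_or_eq.1 hi with hi | rfl
    · rw [hold _ (by omega), List.getElem?_append_left (by rw [h.length]; exact hi)]
      exact h.out i hi
    · rw [hnew, List.getElem?_append_right (by rw [h.length])]
      exact ⟨h.isId _ (by omega) (by omega), by simp [h.length]⟩
  · intro i hi
    rcases Nat.lt_succ_iff_lt_or_eq.1 hi with hi | rfl
    · rw [hold _ (by omega)]
      exact h.hole i hi
    · rw [hself]
      omega
  · intro a ha
    push_cast at ha
    rw [hne a (by omega), h2.frame a (by omega), rootOut, Function.update_of_ne (by omega),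
      Function.update_of_ne (by omega), h.free a (by omega)]

/-- Two history cells are used: one receives the number at the root, the other the address of the
leaf where the hole ends. After the descent variable `14` holds `m` and `15` holds `0`; adding `14`
to `15` and subtracting back resets both without overwriting. -/
theorem yields_extractBody (hB : B ≤ 2 ^ (K * w)) (hBm : 10 * 2 ^ m ≤ B) (hn : n ≤ 2 ^ m)
    (hκ : κ (2 * n) = 0) (h : ExtractInv n m κ T j O M) (hj : j < 2 ^ m - 1 + n) (g : ℤ) :
    extractBody.Yields K 17 B (inputCells n)
      ⟨[n, m, 2 ^ m, 2 * n, 0, j, 2 ^ m - 1 + n - j, 3 * 2 ^ m + 3 * n + 2 * j, 0, g,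
        0, 0, 0, 0, 0, m, 0], M, κ⟩ (5 + ((m * (41 + 3) + 3) + 6))
      fun σ => ∃ O M, ExtractInv n m κ T (j + 1) O M ∧
        σ = ⟨[n, m, 2 ^ m, 2 * n, 0, (j + 1 : ℕ), 2 ^ m - 1 + n - (j + 1 : ℕ),
          3 * 2 ^ m + 3 * n + 2 * (j + 1 : ℕ), 0, g, 0, 0, 0, 0, 0, m, 0], M, κ⟩ := by
  have hpow : (1 : ℤ) ≤ 2 ^ m := by exact_mod_cast Nat.one_le_two_pow
  have hmP : (m : ℤ) < 2 ^ m := by exact_mod_cast Nat.lt_two_pow_self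
  have hnP : (n : ℤ) ≤ 2 ^ m := by exact_mod_cast hn
  have hjP : (j : ℤ) < 2 ^ m - 1 + n := by
    have : ((2 ^ m - 1 + n : ℕ) : ℤ) = 2 ^ m - 1 + n := by
      push_cast [Nat.one_le_two_pow]
      ring
    omega
  refine Stmt.Yields.seq (R := (· = ⟨[n, m, 2 ^ m, 2 * n, 0, j, 2 ^ m - 1 + n - j,
    3 * 2 ^ m + 3 * n + 2 * j + 1, 0, g, 0, 0, 0, 2 ^ m + 1, 0, m, 0], rootOut n m j M, κ⟩)) ?_ ?_
  · refine yields_block hB (by simp) ?_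
    have h1 := h.free _ le_rfl
    unfold rootOut
    generalize (2 : ℤ) ^ m = P at *
    iterate 5
      refine wp_cons ?_ ?_
      · first
        | (simp [Ok, IState.get]; done)
        | (simp [Ok, IState.get]; omega)
      simp (disch := omega) only [eval, IState.setVar, IState.setMem, IState.get,
        List.set_cons_succ, List.set_cons_zero, List.getD_cons_succ, List.getD_cons_zero, zero_add,
        Function.update_of_ne, h1]
    exact wp_nil rfl
  rintro _ rfl
  refine Stmt.Yields.seq (yields_pullLoop hB hBm hn hκ (fun d hd => ?_) h.holeInv _ _ _ _) ?_
  · rw [rootOut_of_ne (by omega) (by omega), h.pow d hd]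
  rintro _ ⟨x, M₂, h2, rfl⟩
  refine yields_block hB (by simp) ?_
  have hM₂ : M₂ (3 * 2 ^ m + 3 * n + 2 * j + 1) = 0 := by
    rw [h2.frame _ (by omega), rootOut, Function.update_of_ne (by omega),
      Function.update_of_ne (by omega), h.free _ (by omega)]
  have hs := h.step hκ h2
  generalize (2 : ℤ) ^ m = P at *
  simp [wp, Ok, eval, IState.setVar, IState.setMem, IState.get, hM₂]
  exact ⟨by omega, ⟨_, hs⟩, by ring, by ring⟩

theorem yields_extractLoop (hB : B ≤ 2 ^ (K * w)) (hBm : 10 * 2 ^ m ≤ B) (hn : n ≤ 2 ^ m)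
    (hκ : κ (2 * n) = 0) (h : ExtractInv n m κ T 0 [] M) (g : ℤ) :
    (Stmt.loop 5 6 extractBody).Yields K 17 B (inputCells n)
      ⟨[n, m, 2 ^ m, 2 * n, 0, 0, 2 ^ m - 1 + n, 3 * 2 ^ m + 3 * n, 0, g,
        0, 0, 0, 0, 0, m, 0], M, κ⟩ ((2 ^ m - 1 + n) * (5 + ((m * (41 + 3) + 3) + 6) + 3) + 3)
      fun σ => ∃ O M, ExtractInv n m κ T (2 ^ m - 1 + n) O M ∧
        σ = ⟨[n, m, 2 ^ m, 2 * n, 0, 2 ^ m - 1 + n, 0,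
          3 * 2 ^ m + 3 * n + 2 * (2 ^ m - 1 + n), 0, g, 0, 0, 0, 0, 0, m, 0], M, κ⟩ := by
  have hpow : (1 : ℤ) ≤ 2 ^ m := by exact_mod_cast Nat.one_le_two_pow
  have hnP : (n : ℤ) ≤ 2 ^ m := by exact_mod_cast hn
  have hE : ((2 ^ m - 1 + n : ℕ) : ℤ) = 2 ^ m - 1 + n := by
    push_cast [Nat.one_le_two_pow]
    ring
  have := Stmt.Yields.loop (S := extractBody) (V := 17) (Q := inputCells n)
    (t := 5 + ((m * (41 + 3) + 3) + 6)) (i := 5) (r := 6) (N := 2 ^ m - 1 + n)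
    (σ := ⟨[n, m, 2 ^ m, 2 * n, 0, 0, 2 ^ m - 1 + n, 3 * 2 ^ m + 3 * n, 0, g,
        0, 0, 0, 0, 0, m, 0], M, κ⟩) hB (by norm_num) (by norm_num) (by omega)
    (fun j σ => ∃ O M, ExtractInv n m κ T j O M ∧
        σ = ⟨[n, m, 2 ^ m, 2 * n, 0, j, 2 ^ m - 1 + n - j,
          3 * 2 ^ m + 3 * n + 2 * j, 0, g, 0, 0, 0, 0, 0, m, 0], M, κ⟩)
    ⟨[], M, h, by simp⟩ ?_ ?_
  · rw [hE] at this
    simpa using this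
  · rintro j hj _ ⟨O, M, _, rfl⟩
    simp only [IState.get, List.getD_cons_succ, List.getD_cons_zero, true_and]
    omega
  · rintro j hj _ ⟨O, M, h, rfl⟩
    exact yields_extractBody hB hBm hn hκ h hj g

end

end

end EnergyRAM

/-! ### The extracted list and its copy in the output array -/

namespace EnergyRAM

open IOp

section

variable {K w n m : ℕ} {κ : ℕ → BitVec w} {B : ℤ}

theorem map_val_Ico_add {α : Type*} (f : ℤ → α) (c : ℤ) (k : ℕ) :
    (Finset.Ico c (c + k)).val.map f = (Multiset.range k).map fun j : ℕ => f (c + j) := by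
  have : Finset.Ico c (c + k) = (Finset.range k).map
      ⟨fun j : ℕ => c + j, fun a b h => by simpa using h⟩ := by
    ext a
    simp only [Finset.mem_Ico, Finset.mem_map, Finset.mem_range]
    constructor
    · intro h
      exact ⟨(a - c).toNat, by omega, show c + ((a - c).toNat : ℤ) = a by omega⟩
    · rintro ⟨j, hj, rfl⟩
      show c ≤ c + (j : ℤ) ∧ c + (j : ℤ) < c + k
      omega
  rw [this, Finset.map_val, Multiset.map_map]
  rfl

theorem idVal_natCast_sub {j : ℕ} : idVal n κ (2 * n - j) = (κ j).toNat := by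
  rw [idVal, show 2 * (n : ℤ) - (2 * n - j) = j by omega, Int.toNat_natCast]

theorem fillMem_inner {g : ℤ} {M : ℤ → ℤ} {a : ℤ} (ha : 2 ^ m ≤ a) (ha' : a < 2 * 2 ^ m) :
    fillMem m (2 ^ m) g M a = g := by
  rw [fillMem, if_pos (by push_cast; omega)]

theorem fillMem_outer {g : ℤ} {M : ℤ → ℤ} {a : ℤ} (ha : a < 2 ^ m ∨ 2 * 2 ^ m ≤ a) :
    fillMem m (2 ^ m) g M a = M a := by
  rw [fillMem, if_neg (by push_cast; omega)]

section

variable {g : ℤ} {M : ℤ → ℤ}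

/-- The three summands come from the inner nodes, the occupied leaves and the empty leaves. -/
theorem LeafInv.treeVals_fillMem (hκ : κ (2 * n) = 0) (hn : n ≤ 2 ^ m)
    (h : LeafInv n m κ n g M) :
    treeVals n m κ (fillMem m (2 ^ m) g M) = Multiset.replicate (2 ^ m - 1) (idVal n κ g) +
      (Multiset.range n).map (fun j => (κ j).toNat) + Multiset.replicate (2 ^ m - n) 0 := by
  have hpow : (1 : ℤ) ≤ 2 ^ m := by exact_mod_cast Nat.one_le_two_pow
  have hnP : (n : ℤ) ≤ 2 ^ m := by exact_mod_cast hn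
  have e1 : ((2 ^ m - 1 : ℕ) : ℤ) = 2 ^ m - 1 := by push_cast [Nat.one_le_two_pow]; ring
  have e2 : ((2 ^ m - n : ℕ) : ℤ) = 2 ^ m - n := by push_cast [hn]; ring
  have hsplit : (Finset.Ioo (2 ^ m : ℤ) (3 * 2 ^ m)).val =
      (Finset.Ico (2 ^ m + 1 : ℤ) (2 ^ m + 1 + (2 ^ m - 1 : ℕ))).val +
      (Finset.Ico (2 * 2 ^ m : ℤ) (2 * 2 ^ m + n)).val +
      (Finset.Ico (2 * 2 ^ m + n : ℤ) (2 * 2 ^ m + n + (2 ^ m - n : ℕ))).val := by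
    rw [e1, e2]
    have d1 : Disjoint (Finset.Ico (2 ^ m + 1 : ℤ) (2 ^ m + 1 + (2 ^ m - 1)))
        (Finset.Ico (2 * 2 ^ m : ℤ) (2 * 2 ^ m + n)) := by
      rw [Finset.disjoint_left]
      intro a
      simp only [Finset.mem_Ico]
      omega
    have d2 : Disjoint (Finset.disjUnion _ _ d1)
        (Finset.Ico (2 * 2 ^ m + n : ℤ) (2 * 2 ^ m + n + (2 ^ m - n))) := by
      rw [Finset.disjoint_left]
      intro a
      simp only [Finset.mem_disjUnion, Finset.mem_Ico]
      omega
    rw [show Finset.Ioo (2 ^ m : ℤ) (3 * 2 ^ m) = Finset.disjUnion _ _ d2 by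
      ext a
      simp only [Finset.mem_disjUnion, Finset.mem_Ico, Finset.mem_Ioo]
      omega]
    rfl
  rw [treeVals, hsplit, Multiset.map_add, Multiset.map_add, map_val_Ico_add, map_val_Ico_add,
    map_val_Ico_add]
  congr 1
  · congr 1
    · rw [Multiset.map_congr (g := fun _ => idVal n κ g) rfl, Multiset.map_const',
        Multiset.card_range]
      intro j hj
      rw [Multiset.mem_range] at hj
      rw [fillMem_inner (by omega) (by omega)]
    · refine Multiset.map_congr rfl fun j hj => ?_
      rw [Multiset.mem_range] at hj
      rw [fillMem_outer (by omega), h.leaf j hj, idVal_natCast_sub]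
  · rw [Multiset.map_congr (g := fun _ => 0) rfl, Multiset.map_const', Multiset.card_range]
    intro j hj
    rw [Multiset.mem_range] at hj
    rw [fillMem_outer (by omega), h.zero' _ (by omega) (by omega), idVal_zero hκ]

/-- Every parent is an inner node and carries the maximum, so the heap condition is immediate. -/
theorem LeafInv.extractInv (hκ : κ (2 * n) = 0) (hn : n ≤ 2 ^ m) (h : LeafInv n m κ n g M) :
    ExtractInv n m κ (treeVals n m κ (fillMem m (2 ^ m) g M)) 0 [] (fillMem m (2 ^ m) g M) := by
  have hpow : (1 : ℤ) ≤ 2 ^ m := by exact_mod_cast Nat.one_le_two_pow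
  have hmP : (m : ℤ) < 2 ^ m := by exact_mod_cast Nat.lt_two_pow_self
  have hnP : (n : ℤ) ≤ 2 ^ m := by exact_mod_cast hn
  have hle : ∀ a : ℤ, 2 ^ m < a → a < 3 * 2 ^ m →
      IsId n (fillMem m (2 ^ m) g M a) ∧ idVal n κ (fillMem m (2 ^ m) g M a) ≤ idVal n κ g := by
    intro a ha ha'
    by_cases h1 : a < 2 * 2 ^ m
    · rw [fillMem_inner ha.le h1]
      exact ⟨h.isId, le_rfl⟩
    · rw [fillMem_outer (by omega)]
      by_cases h2 : a < 2 * 2 ^ m + n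
      · obtain ⟨j, rfl⟩ : ∃ j : ℕ, a = 2 * 2 ^ m + j := ⟨(a - 2 * 2 ^ m).toNat, by omega⟩
        rw [h.leaf j (by omega), idVal_natCast_sub]
        exact ⟨Or.inr (by omega), h.max j (by omega)⟩
      · rw [h.zero' a (by omega) ha', idVal_zero hκ]
        exact ⟨Or.inl rfl, Nat.zero_le _⟩
  refine ⟨fun d hd => ?_, fun a ha ha' => (hle a ha ha').1, ?_, by simp, List.Pairwise.nil,
    by simp, rfl, by simp, by simp, fun a ha => ?_⟩
  · rw [fillMem_outer (by omega), h.pow d hd]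
  · intro d hd x hx
    have h1 : 2 ^ (d + 1) ≤ 2 ^ m := Nat.pow_le_pow_right (by norm_num) hd
    have h2 : 2 ^ (d + 1) = 2 * 2 ^ d := by ring
    have h0 : fillMem m (2 ^ m) g M (2 ^ m + (2 ^ d + x : ℕ)) = g := by
      have : ((2 ^ d + x : ℕ) : ℤ) < (2 ^ m : ℕ) := by
        rw [Int.ofNat_lt]
        omega
      have hp : (0 : ℤ) < 2 ^ d := by positivity
      push_cast at this ⊢
      exact fillMem_inner (by omega) (by omega)
    have hu : ∀ u : ℕ, 0 < u → u < 2 * 2 ^ m →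
        idVal n κ (fillMem m (2 ^ m) g M (2 ^ m + u)) ≤ idVal n κ g := by
      intro u hu hu'
      have : (u : ℤ) < 2 * 2 ^ m := by exact_mod_cast hu'
      exact (hle _ (by omega) (by omega)).2
    simp only [h0]
    have hp : 0 < 2 ^ d := by positivity
    exact ⟨hu _ (by omega) (by omega), hu _ (by omega) (by omega)⟩
  · rw [fillMem_outer (by push_cast at ha; omega), h.free a (by simpa using ha)]

end

/-- Sort the numbers of the elements; the result is left in the memory, together with `Θ(n)`
further cells that are needed for the way back. -/
def sortStmt : Stmt :=
  .seq powStmt (.seq setupStmt (.seq (.loop 5 6 leafBody) (.seq fillStmt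
    (.seq (.loop 5 6 extractBody) (IOp.block (.sub 5 2) [.inc 5, .sub 5 0])))))

/-- The running time of `sortStmt`. -/
def sortTime (n m : ℕ) : ℕ :=
  (4 + (m * (10 + 3) + 3)) + (9 + ((n * (22 + 3) + 3) + ((4 + ((2 ^ m * (4 + 3) + 3) + 7)) +
    (((2 ^ m - 1 + n) * (5 + ((m * (41 + 3) + 3) + 6) + 3) + 3) + 3))))

/-- The memory after `sortStmt`, when `ρ` is the sorted array. -/
structure IsSorted (n m : ℕ) (κ ρ : ℕ → BitVec w) (M : ℤ → ℤ) : Prop where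
  out : ∀ j < n, IsId n (M (3 * 2 ^ m + 3 * n + 2 * (2 ^ m - 1 + n) - 2 * j - 2)) ∧
    κ (2 * n - M (3 * 2 ^ m + 3 * n + 2 * (2 ^ m - 1 + n) - 2 * j - 2)).toNat = ρ j
  pos : ∀ i : ℕ, i < n → 0 < M (3 * 2 ^ m + 3 * n + 2 * i + 1) ∧
    M (3 * 2 ^ m + 3 * n + 2 * i + 1) < 3 * 2 ^ m

/-- Only values are tracked, not the identity of elements: among equal keys an output may name a
filler, or the empty key cell if the key is zero. This is harmless because keys of equal value are
equal words. -/
theorem ExtractInv.isSorted {g : ℤ} {M M' : ℤ → ℤ} {O : List ℕ} {ρ : ℕ → BitVec w}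
    (hκ : κ (2 * n) = 0) (hn : n ≤ 2 ^ m) (h : LeafInv n m κ n g M')
    (hρ : ((List.range n).map fun j => (ρ j).toNat).Perm
      ((List.range n).map fun j => (κ j).toNat))
    (hmono : ∀ i j, i ≤ j → j < n → (ρ i).toNat ≤ (ρ j).toNat)
    (hE : ExtractInv n m κ (treeVals n m κ (fillMem m (2 ^ m) g M')) (2 ^ m - 1 + n) O M) :
    IsSorted n m κ ρ M := by
  have hP : 1 ≤ 2 ^ m := Nat.one_le_two_pow
  set D : List ℕ := ((List.range n).map fun j => (ρ j).toNat).reverse with hD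
  have hDlen : D.length = n := by simp [hD]
  have hO : O = List.replicate (2 ^ m - 1) (idVal n κ g) ++ D := by
    -- The zeros are those of the empty leaves and one for each extraction.
    refine eq_replicate_append (S := treeVals n m κ M) (c := 2 ^ m - n + (2 ^ m - 1 + n)) ?_
      hE.sorted hE.le ?_ ?_ (by rw [hE.length, hDlen])
    · have hDm : (D : Multiset ℕ) = (Multiset.range n).map (fun j => (κ j).toNat) := by
        rw [hD, Multiset.coe_reverse]
        exact Multiset.coe_eq_coe.2 hρ
      rw [hE.vals, h.treeVals_fillMem hκ hn, Multiset.replicate_add (2 ^ m - n), ← Multiset.coe_add,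
        hDm, Multiset.coe_replicate, add_assoc _ (Multiset.replicate (2 ^ m - n) 0)]
    · rw [hD, List.pairwise_reverse, List.pairwise_map]
      refine List.pairwise_lt_range.imp_of_mem fun {a b} ha hb hab => ?_
      exact hmono a b hab.le (List.mem_range.1 hb)
    · intro x hx
      rw [hD, List.mem_reverse, hρ.mem_iff, List.mem_map] at hx
      obtain ⟨j, hj, rfl⟩ := hx
      exact h.max j (List.mem_range.1 hj)
  refine ⟨fun j hj => ?_, fun i hi => hE.hole i (by omega)⟩
  -- The extracted list descends, so entry `j` of the sorted array stands `j` places before its last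
  -- entry.
  obtain ⟨h1, h2⟩ := hE.out (2 ^ m - 1 + n - 1 - j) (by omega)
  have e : (3 * 2 ^ m + 3 * n + 2 * (2 ^ m - 1 + n) - 2 * j - 2 : ℤ) =
      3 * 2 ^ m + 3 * n + 2 * (2 ^ m - 1 + n - 1 - j : ℕ) := by
    have : ((2 ^ m - 1 + n - 1 - j : ℕ) : ℤ) = (2 ^ m : ℕ) + n - 2 - j := by omega
    rw [this]
    push_cast
    ring
  rw [e]
  refine ⟨h1, ?_⟩
  rw [hO, List.getElem?_append_right (by simp; omega), List.length_replicate,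
    show 2 ^ m - 1 + n - 1 - j - (2 ^ m - 1) = n - 1 - j by omega, hD,
    List.getElem?_reverse (by simp; omega)] at h2
  simp only [List.length_map, List.length_range, List.getElem?_map] at h2
  rw [show n - 1 - (n - 1 - j) = j by omega, List.getElem?_range hj] at h2
  simp only [Option.map_some, Option.some.injEq] at h2
  exact BitVec.eq_of_toNat_eq h2.symm

theorem yields_sortStmt (hB : B ≤ 2 ^ (K * w)) (hBm : 10 * 2 ^ m ≤ B) (hm : 1 ≤ m)
    (hn : n ≤ 2 ^ m) (hlt : ∀ k, 1 ≤ k → k < m → 2 ^ k < n) (hκ : κ (2 * n) = 0)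
    {ρ : ℕ → BitVec w} (hρ : ((List.range n).map fun j => (ρ j).toNat).Perm
      ((List.range n).map fun j => (κ j).toNat))
    (hmono : ∀ i j, i ≤ j → j < n → (ρ i).toNat ≤ (ρ j).toNat) :
    sortStmt.Yields K 17 B (inputCells n)
      ⟨[n, 0, 0, 0, 0, 0, 0, 0, 0, 0, 0, 0, 0, 0, 0, 0, 0], 0, κ⟩ (sortTime n m)
      fun σ => ∃ g M, IsSorted n m κ ρ M ∧
        σ = ⟨[n, m, 2 ^ m, 2 * n, 0, 0, 0, 3 * 2 ^ m + 3 * n + 2 * (2 ^ m - 1 + n), 0, g,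
          0, 0, 0, 0, 0, m, 0], M, κ⟩ := by
  refine (yields_powStmt hB hBm hm hn hlt).seq ?_
  rintro _ rfl
  refine (yields_setupStmt hB hBm).seq ?_
  rintro _ rfl
  refine (yields_leafLoop hB hBm hn).seq ?_
  rintro _ ⟨g, M', h, rfl⟩
  refine (yields_fillStmt hB hBm h).seq ?_
  rintro _ rfl
  refine (yields_extractLoop hB hBm hn hκ (h.extractInv hκ hn) g).seq ?_
  rintro _ ⟨O, M, hE, rfl⟩
  -- The counter ends at `2 ^ m - 1 + n` and is cleared by subtracting known quantities, so that the
  -- copying loop can use it.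
  refine yields_block hB (by simp) ?_
  have := hE.isSorted hκ hn h hρ hmono
  simp [wp, Ok, eval, IState.setVar, IState.get, this]
  ring

/-- Copy the result to the output array. -/
def copyBody : Stmt :=
  IOp.block (.dec 7) [.dec 7, .add 11 3, .unload 11 7, .add 12 0, .add 12 5, .keyCopy 11 12,
    .sub 12 5, .sub 12 0, .load 11 7, .sub 11 3, .inc 5, .dec 6]

/-- The key cells after copying `k` elements. -/
def copyKeys (n k : ℕ) (ρ κ : ℕ → BitVec w) (a : ℕ) : BitVec w :=
  if n ≤ a ∧ a < n + k then ρ (a - n) else κ a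

/-- Copy the result to the output array and restore the index cells. -/
def copyStmt : Stmt :=
  .seq (IOp.block (.add 6 0) []) (.seq (.loop 5 6 copyBody) (IOp.block (.sub 5 0) [.add 7 0, .add 7 0]))

theorem copyKeys_succ {ρ : ℕ → BitVec w} (k : ℕ) : copyKeys n (k + 1) ρ κ =
    Function.update (copyKeys n k ρ κ) (n + k) (ρ k) := by
  funext a
  rw [Function.update_apply]
  by_cases h : a = n + k
  · rw [if_pos h, copyKeys, if_pos (by omega), h, Nat.add_sub_cancel_left]
  · simp only [if_neg h, copyKeys]
    congr 1
    rw [eq_iff_iff]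
    omega

/-- The history is read backwards, which turns descending into ascending order. A source address is
below `n` or equal to `2 * n`; such cells are never written here, and they differ from the target `n
+ k` because `k < n`. -/
theorem yields_copyBody (hB : B ≤ 2 ^ (K * w)) (hBm : 10 * 2 ^ m ≤ B) (hn : n ≤ 2 ^ m)
    (hκ : ∀ a, n ≤ a → κ a = 0) {ρ : ℕ → BitVec w} {M : ℤ → ℤ} (h : IsSorted n m κ ρ M) {k : ℕ}
    (hk : k < n) {A : ℤ} (hA : A = 3 * 2 ^ m + 3 * n + 2 * (2 ^ m - 1 + n)) (g : ℤ) :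
    copyBody.Yields K 17 B {a | a ≤ 2 * n}
      ⟨[n, m, 2 ^ m, 2 * n, 0, k, n - k, A - 2 * k, 0, g, 0, 0, 0, 0, 0, m, 0], M,
        copyKeys n k ρ κ⟩ 13
      (· = ⟨[n, m, 2 ^ m, 2 * n, 0, (k + 1 : ℕ), n - (k + 1 : ℕ), A - 2 * (k + 1 : ℕ), 0, g,
        0, 0, 0, 0, 0, m, 0], M, copyKeys n (k + 1) ρ κ⟩) := by
  have hpow : (1 : ℤ) ≤ 2 ^ m := by exact_mod_cast Nat.one_le_two_pow
  have hnP : (n : ℤ) ≤ 2 ^ m := by exact_mod_cast hn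
  obtain ⟨hid, hval⟩ := h.out k hk
  rw [← hA, show A - 2 * k - 2 = A - 2 * (k : ℤ) - 1 - 1 by ring] at hid hval
  have hsrc : copyKeys n k ρ κ (2 * n - M (A - 2 * (k : ℤ) - 1 - 1)).toNat = ρ k := by
    rw [copyKeys, if_neg, hval]
    simp only [IsId] at hid
    omega
  have hdst : copyKeys n k ρ κ (n + k) = 0 := by
    rw [copyKeys, if_neg (by omega), hκ _ (by omega)]
  have hdst' : (n + k : ℤ).toNat = n + k := by omega
  have hids := hid
  simp only [IsId] at hids
  have hsrcQ : (2 * n - M (A - 2 * (k : ℤ) - 1 - 1)).toNat ∈ {a | a ≤ 2 * n} := by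
    rw [Set.mem_ofPred_eq]
    omega
  have hdstQ : (n + k : ℤ).toNat ∈ {a | a ≤ 2 * n} := by
    rw [Set.mem_ofPred_eq]
    omega
  refine yields_block hB (by simp) ?_
  generalize (2 : ℤ) ^ m = P at *
  have hBA : 0 ≤ A - 2 * (k : ℤ) - 1 - 1 ∧ A - 2 * (k : ℤ) - 1 - 1 < B := by omega
  iterate 13
    refine wp_cons ?_ ?_
    · first
      | (simp [Ok, IState.get]; done)
      | (simp [Ok, IState.get]; omega)
      | (simp only [Ok, IState.get, List.getD_cons_succ, List.getD_cons_zero]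
         exact ⟨by simp, ⟨by omega, by omega, hsrcQ⟩, ⟨by omega, by omega, hdstQ⟩, by omega, by rw [hdst', hdst]⟩)
    simp only [eval, IState.setVar, IState.get, List.set_cons_succ, List.set_cons_zero,
      List.getD_cons_succ, List.getD_cons_zero, zero_add, add_sub_cancel_right, sub_self,
      hsrc, hdst', sub_add_cancel]
  apply wp_nil
  rw [copyKeys_succ]
  simp
  refine ⟨by ring, by ring⟩

theorem yields_copyStmt (hB : B ≤ 2 ^ (K * w)) (hBm : 10 * 2 ^ m ≤ B) (hn : n ≤ 2 ^ m)
    (hκ : ∀ a, n ≤ a → κ a = 0) {ρ : ℕ → BitVec w} {M : ℤ → ℤ} (h : IsSorted n m κ ρ M)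
    {A : ℤ} (hA : A = 3 * 2 ^ m + 3 * n + 2 * (2 ^ m - 1 + n)) (g : ℤ) :
    copyStmt.Yields K 17 B {a | a ≤ 2 * n}
      ⟨[n, m, 2 ^ m, 2 * n, 0, 0, 0, A, 0, g, 0, 0, 0, 0, 0, m, 0], M, κ⟩
      (1 + ((n * (13 + 3) + 3) + 3))
      (· = ⟨[n, m, 2 ^ m, 2 * n, 0, 0, 0, A, 0, g, 0, 0, 0, 0, 0, m, 0], M,
        copyKeys n n ρ κ⟩) := by
  have hpow : (1 : ℤ) ≤ 2 ^ m := by exact_mod_cast Nat.one_le_two_pow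
  have hnP : (n : ℤ) ≤ 2 ^ m := by exact_mod_cast hn
  refine Stmt.Yields.seq (R := (· = ⟨[n, m, 2 ^ m, 2 * n, 0, 0, n, A, 0, g, 0, 0, 0, 0, 0, m, 0], M,
    κ⟩)) ?_ ?_
  · refine yields_block hB (by simp) ?_
    simp [wp, Ok, eval, IState.setVar, IState.get]
  rintro _ rfl
  refine Stmt.Yields.seq (R := (· = ⟨[n, m, 2 ^ m, 2 * n, 0, n, 0, A - 2 * n, 0, g,
    0, 0, 0, 0, 0, m, 0], M, copyKeys n n ρ κ⟩)) ?_ ?_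
  · have := Stmt.Yields.loop (S := copyBody) (V := 17) (Q := {a | a ≤ 2 * n}) (t := 13) (i := 5)
      (r := 6) (N := n)
      (σ := ⟨[n, m, 2 ^ m, 2 * n, 0, 0, n, A, 0, g, 0, 0, 0, 0, 0, m, 0], M, κ⟩) hB
      (by norm_num) (by norm_num) (by omega)
      (fun k σ => σ = ⟨[n, m, 2 ^ m, 2 * n, 0, k, n - k, A - 2 * k, 0, g, 0, 0, 0, 0, 0, m, 0], M,
        copyKeys n k ρ κ⟩) ?_ ?_ ?_
    · simpa using this
    · have : copyKeys n 0 ρ κ = κ := by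
        funext a
        rw [copyKeys, if_neg (by omega)]
      simp [this]
    · rintro k hk _ rfl
      simp only [IState.get, List.getD_cons_succ, List.getD_cons_zero, true_and]
      omega
    · rintro k hk _ rfl
      exact yields_copyBody hB hBm hn hκ h hk hA g
  rintro _ rfl
  refine yields_block hB (by simp) ?_
  simp [wp, Ok, eval, IState.setVar, IState.get]
  ring

end

end EnergyRAM

/-! ### Compute, copy, uncompute -/

namespace EnergyRAM

theorem isFree_sortStmt : sortStmt.IsFree := by
  simp [sortStmt, powStmt, powBody, setupStmt, leafBody, fillStmt, fillBody, extractBody, pullBody,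
    Stmt.IsFree, IOp.isFree_block]

theorem isFree_copyStmt : copyStmt.IsFree := by
  simp [copyStmt, copyBody, Stmt.IsFree, IOp.isFree_block]

/-- Sort, copy the result, and undo the sorting. -/
def mainStmt : Stmt := .seq sortStmt (.seq copyStmt sortStmt.inv)

/-- The sorting program. -/
def sortProgram (K : ℕ) : Program := ⟨K, mainStmt.compile 0⟩

theorem reversible_sortProgram (K : ℕ) : (sortProgram K).Reversible :=
  Program.reversible_of_isFree _ fun _ ho =>
    Stmt.IsFree.of_mem_compile (S := mainStmt)
      ⟨isFree_sortStmt, isFree_copyStmt, isFree_sortStmt.inv⟩ ho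

theorem region_mono {V : ℕ} {B : ℤ} {Q Q' : Set ℕ} (h : Q ⊆ Q') : region V B Q ⊆ region V B Q' := by
  rintro ((i | a) | a) hc
  · exact hc
  · exact hc
  · exact h hc

section

variable {w n : ℕ} (L : Fin n → BitVec w)

/-- The array in sorted order. -/
def sortedArray : Fin n → BitVec w := L ∘ Tuple.sort fun i => (L i).toNat

theorem isSortedCopy_sortedArray : IsSortedCopy L (sortedArray L) :=
  ⟨fun _ _ hij => Tuple.monotone_sort (fun i => (L i).toNat) hij, _, fun _ => rfl⟩

/-- An array as a function on addresses. -/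
def padZero (a : ℕ) : BitVec w := if h : a < n then L ⟨a, h⟩ else 0

theorem map_range_padZero :
    ((List.range n).map fun j => (padZero L j).toNat) = List.ofFn fun i => (L i).toNat := by
  apply List.ext_getElem
  · simp
  · intro i h1 h2
    have hi : i < n := by simpa using h1
    simp [padZero, hi]

theorem perm_padZero_sortedArray :
    ((List.range n).map fun j => (padZero (sortedArray L) j).toNat).Perm
      ((List.range n).map fun j => (padZero L j).toNat) := by
  rw [map_range_padZero, map_range_padZero]
  exact Equiv.Perm.ofFn_comp_perm (Tuple.sort fun i => (L i).toNat) fun i => (L i).toNat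

theorem monotone_padZero_sortedArray (i j : ℕ) (hij : i ≤ j) (hj : j < n) :
    (padZero (sortedArray L) i).toNat ≤ (padZero (sortedArray L) j).toNat := by
  rw [padZero, padZero, dif_pos hj, dif_pos (hij.trans_lt hj)]
  exact (isSortedCopy_sortedArray L).1 _ _ hij

theorem startConfig_eq (K : ℕ) : startConfig (sortProgram K) L = ⟨0, IState.toState K
    ⟨[n, 0, 0, 0, 0, 0, 0, 0, 0, 0, 0, 0, 0, 0, 0, 0, 0], 0, padZero L⟩⟩ := by
  simp only [startConfig, IState.toState]
  congr 2
  funext c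
  rcases c with i | a
  · rcases i with _ | i
    · simp [lengthOnly, IState.get, sortProgram]
    · have : ([0, 0, 0, 0, 0, 0, 0, 0, 0, 0, 0, 0, 0, 0, 0, 0] : List ℤ).getD i 0 = 0 := by
        rw [List.getD_eq_getElem?_getD]
        by_cases hi : i < 16
        · interval_cases i <;> rfl
        · rw [List.getElem?_eq_none (by simp; omega)]
          rfl
      simp only [IState.get, List.getD_cons_succ, this]
      simp [lengthOnly]
      rfl
  · simp [lengthOnly]
    rfl

variable {L}

/-- This is the form in which the inverse of `sortStmt` delivers its final state: the start state
with the keys outside the sorting region replaced. -/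
theorem endConfig_eq (K : ℕ) (B : ℤ) : endConfig (sortProgram K) L (sortedArray L) =
    ⟨mainStmt.size, State.replaceKeys (region 17 B (inputCells n))
      (copyKeys n n (padZero (sortedArray L)) (padZero L))
      (startConfig (sortProgram K) L).state⟩ := by
  rw [endConfig, Config.mk.injEq]
  refine ⟨Stmt.length_compile _ _, ?_⟩
  · simp only [startConfig, State.replaceKeys]
    congr 1
    funext a
    simp only [copyKeys, padZero]
    have : Cell.key a ∈ region 17 B (inputCells n) ↔ a < n ∨ a = 2 * n := Iff.rfl
    simp only [this]
    split_ifs <;> first | rfl | omega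

theorem replaceKeys_toState {K : ℕ} {B : ℤ} {ρ κ : ℕ → BitVec w} (l : List ℤ) (M : ℤ → ℤ) :
    State.replaceKeys (region 17 B (inputCells n)) (copyKeys n n ρ κ)
      (IState.toState K ⟨l, M, κ⟩) = IState.toState K ⟨l, M, copyKeys n n ρ κ⟩ := by
  simp only [State.replaceKeys, IState.toState]
  congr 1
  funext a
  have : Cell.key a ∈ region 17 B (inputCells n) ↔ a < n ∨ a = 2 * n := Iff.rfl
  simp only [copyKeys, this]
  split_ifs <;> first | rfl | omega

/-- The run of the sorting program. -/
theorem exists_run_sortProgram {K m : ℕ} (hB : 10 * 2 ^ m ≤ 2 ^ (K * w)) (hm : 1 ≤ m)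
    (hn : n ≤ 2 ^ m) (hlt : ∀ k, 1 ≤ k → k < m → 2 ^ k < n) :
    ∃ A : Finset Cell, (sortProgram K).Run (startConfig (sortProgram K) L)
        (2 * sortTime n m + (16 * n + 7)) 0 A (endConfig (sortProgram K) L (sortedArray L)) ∧
      (∀ i < n, Cell.idx (.mem (3 * 2 ^ m + 3 * n + 2 * i + 1)) ∈ A) ∧
      ↑A ⊆ region 17 (10 * 2 ^ m) {a | a ≤ 2 * n} := by
  have hB' : (10 * 2 ^ m : ℤ) ≤ 2 ^ (K * w) := by exact_mod_cast hB
  obtain ⟨σ₁, hs, g, M, hM, rfl⟩ := yields_sortStmt (κ := padZero L)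
    (ρ := padZero (sortedArray L)) hB' le_rfl hm hn hlt
    (by rw [padZero, dif_neg (by omega)]) (perm_padZero_sortedArray L)
    (monotone_padZero_sortedArray L)
  obtain ⟨_, hc, rfl⟩ := yields_copyStmt hB' le_rfl hn
    (fun a ha => by rw [padZero, dif_neg (by omega)]) hM rfl g
  -- The inverse is first obtained for the keys before copying, and then moved to the state that
  -- contains the output.
  have hi := (hs.inv isFree_sortStmt).replaceKeys
    (copyKeys n n (padZero (sortedArray L)) (padZero L))
  have hsub : region 17 (10 * 2 ^ m) (inputCells n) ⊆ region 17 (10 * 2 ^ m) {a | a ≤ 2 * n} :=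
    region_mono fun a ha => by
      simp only [inputCells, Set.mem_ofPred_eq] at ha ⊢
      omega
  rw [replaceKeys_toState] at hi
  have hat : Stmt.At (sortProgram K) mainStmt 0 := fun k _ => by rw [Nat.zero_add]; rfl
  have hend : ∀ s : State K w, (sortProgram K).EntersFromAbove
      (0 + sortStmt.size + (Stmt.seq copyStmt sortStmt.inv).size) s := by
    intro s c src h
    have : (sortProgram K).code[0 + sortStmt.size + (Stmt.seq copyStmt sortStmt.inv).size]? =
        none := by
      rw [List.getElem?_eq_none]
      rw [Nat.zero_add]
      exact (Stmt.length_compile mainStmt 0).le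
    rw [this] at h
    cases h
  have hlast : (Stmt.seq copyStmt sortStmt.inv).Exec _ _ _ _ :=
    ⟨_, _, _, hc, hi.mono hsub, rfl⟩
  obtain ⟨A₁, hA₁, r₁⟩ := Stmt.Exec.run (P := sortProgram K) isFree_sortStmt hat.seq_left hs
    (Stmt.Exec.entersFromAbove (P := sortProgram K) hat.seq_right hlast)
  obtain ⟨A₂, hA₂, r₂⟩ := Stmt.Exec.run (P := sortProgram K) (S := .seq copyStmt sortStmt.inv)
    ⟨isFree_copyStmt, isFree_sortStmt.inv⟩ hat.seq_right hlast (hend _)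
  refine ⟨A₁ ∪ A₂, ?_, fun i hi => ?_, ?_⟩
  · have r := r₁.trans r₂
    rw [endConfig_eq K (10 * 2 ^ m), startConfig_eq]
    rw [show sortTime n m + (1 + (n * (13 + 3) + 3 + 3) + sortTime n m) =
      2 * sortTime n m + (16 * n + 7) by ring, Nat.zero_add, Nat.add_zero] at r
    exact r
  -- If such a cell were not accessed while sorting, it would still hold its initial `0`; but it
  -- holds the address of a leaf.
  · by_contra hA
    rw [Finset.mem_union, not_or] at hA
    have h := r₁.idx_eq_of_notMem hA.1
    obtain ⟨h0, h1⟩ := hM.pos i hi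
    have hpow : (1 : ℤ) ≤ 2 ^ m := by exact_mod_cast Nat.one_le_two_pow
    refine ofInt_ne_zero h0 (h1.trans_le ((by omega : (3 * 2 ^ m : ℤ) ≤ 10 * 2 ^ m).trans hB')) ?_
    simp [IState.toState] at h
    exact h
  · rw [Finset.coe_union]
    exact Set.union_subset (hA₁.trans hsub) hA₂

end

end EnergyRAM

/-! ### Bounds on time and space -/

namespace EnergyRAM

theorem le_auxWords {K n : ℕ} (hK : 1 ≤ K) {c : ℕ} {A : Finset Cell}
    (h : ∀ i < n, Cell.idx (.mem (c + 2 * i + 1)) ∈ A) : n ≤ auxWords K n A := by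
  have hsub : (Finset.range n).image (fun i => Cell.idx (.mem (c + 2 * i + 1))) ⊆
      A \ (Finset.range (2 * n)).image Cell.key := by
    intro x hx
    obtain ⟨i, hi, rfl⟩ := Finset.mem_image.1 hx
    simp [h i (Finset.mem_range.1 hi)]
  calc n = ∑ x ∈ (Finset.range n).image (fun i => Cell.idx (.mem (c + 2 * i + 1))), 1 := by
        rw [Finset.sum_const, Finset.card_image_of_injective, Finset.card_range]
        · simp
        · intro a b hab
          simp only [Cell.idx.injEq, ICell.mem.injEq] at hab
          omega
    _ ≤ ∑ x ∈ A \ (Finset.range (2 * n)).image Cell.key, 1 := Finset.sum_le_sum_of_subset hsub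
    _ ≤ auxWords K n A := by
        refine Finset.sum_le_sum fun x _ => ?_
        cases x
        · exact hK
        · exact le_rfl

/-- The summand `1` is for the empty key cell at `2 * n`, the only accessible key cell outside the
two arrays. -/
theorem auxWords_le {K n V B : ℕ} (hK : 1 ≤ K) {A : Finset Cell}
    (h : ↑A ⊆ region V B {a | a ≤ 2 * n}) : auxWords K n A ≤ (V + B + 1) * K := by
  have hsub : A \ (Finset.range (2 * n)).image Cell.key ⊆
      (Finset.range V).image (fun i => Cell.idx (.var i)) ∪
        (Finset.range B).image (fun a => Cell.idx (.mem a)) ∪ {Cell.key (2 * n)} := by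
    intro x hx
    obtain ⟨hx, hx'⟩ := Finset.mem_sdiff.1 hx
    have hr := h (Finset.mem_coe.2 hx)
    rcases x with (i | a) | a
    · have : i < V := hr
      simp [this]
    · have : (a : ℤ) < B := hr
      have : a < B := by omega
      simp [this]
    · have : a ≤ 2 * n := hr
      have h2 : ¬ a < 2 * n := by simpa using hx'
      have : a = 2 * n := by omega
      simp [this]
  calc auxWords K n A ≤ ∑ x ∈ A \ (Finset.range (2 * n)).image Cell.key, K := by
        refine Finset.sum_le_sum fun x _ => ?_
        cases x
        · exact le_rfl
        · exact hK
    _ ≤ (V + B + 1) * K := by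
        rw [Finset.sum_const, smul_eq_mul]
        refine Nat.mul_le_mul_right _ ((Finset.card_le_card hsub).trans ?_)
        refine (Finset.card_union_le _ _).trans (Nat.add_le_add ?_ (by simp))
        refine (Finset.card_union_le _ _).trans (Nat.add_le_add ?_ ?_)
        · exact Finset.card_image_le.trans (by simp)
        · exact Finset.card_image_le.trans (by simp)

theorem mul_le_sortTime (n m : ℕ) : n * m ≤ sortTime n m := by
  have : n * m ≤ (2 ^ m - 1 + n) * (5 + ((m * (41 + 3) + 3) + 6) + 3) :=
    Nat.mul_le_mul (by omega) (by omega)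
  unfold sortTime
  omega

theorem sortTime_le {n m : ℕ} (h : 2 ^ m ≤ 2 * n) :
    sortTime n m ≤ 13 * m + 39 + 39 * n + 3 * n * (44 * m + 17) := by
  have : (2 ^ m - 1 + n) * (5 + ((m * (41 + 3) + 3) + 6) + 3) ≤ 3 * n * (44 * m + 17) :=
    Nat.mul_le_mul (by omega) (by omega)
  unfold sortTime
  omega

/-- The running time of the sorting program is `Θ(n lg n)`. -/
theorem sortTime_bounds {n m : ℕ} (hm : m = max 1 (Nat.clog 2 n)) :
    n * Real.logb 2 n ≤ (2 * sortTime n m + (16 * n + 7) : ℕ) ∧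
      ((2 * sortTime n m + (16 * n + 7) : ℕ) : ℝ) ≤ 1000 * (n * Real.logb 2 n + 1) := by
  -- For `n < 2` the logarithmic term vanishes, and the constant running time is covered by the `+
  -- 1`.
  rcases Nat.lt_or_ge n 2 with hn | hn
  · have h0 : Nat.clog 2 n = 0 := Nat.clog_of_right_le_one (by omega) 2
    rw [h0] at hm
    subst hm
    interval_cases n <;> norm_num [sortTime]
  have hn1 : (2 : ℝ) ≤ n := by exact_mod_cast hn
  have hc : 1 ≤ Nat.clog 2 n := Nat.clog_pos (by norm_num) hn
  rw [max_eq_right hc] at hm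
  have hle : n ≤ 2 ^ m := hm ▸ Nat.le_pow_clog (by norm_num) n
  have hlt : 2 ^ (m - 1) < n := hm ▸ Nat.pow_pred_clog_lt_self (by norm_num) hn
  have h1 : Real.logb 2 n ≤ m := by
    rw [Real.logb_le_iff_le_rpow (by norm_num) (by linarith), Real.rpow_natCast]
    exact_mod_cast hle
  have h2 : ((m - 1 : ℕ) : ℝ) ≤ Real.logb 2 n := by
    rw [Real.le_logb_iff_rpow_le (by norm_num) (by linarith), Real.rpow_natCast]
    exact_mod_cast hlt.le
  have h3 : 1 ≤ Real.logb 2 n := by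
    rw [Real.le_logb_iff_rpow_le (by norm_num) (by linarith), Real.rpow_one]
    exact hn1
  rw [Nat.cast_sub (hm ▸ hc), Nat.cast_one] at h2
  have h4 : 2 ^ m ≤ 2 * n := by
    rw [show m = m - 1 + 1 by omega, pow_succ]
    omega
  set x := Real.logb 2 n
  constructor
  · have hT : ((n * m : ℕ) : ℝ) ≤ (2 * sortTime n m + (16 * n + 7) : ℕ) := by
      have := mul_le_sortTime n m
      exact_mod_cast (by omega)
    push_cast at hT ⊢
    nlinarith
  · have hT : ((2 * sortTime n m + (16 * n + 7) : ℕ) : ℝ) ≤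
        (2 * (13 * m + 39 + 39 * n + 3 * n * (44 * m + 17)) + (16 * n + 7) : ℕ) := by
      have := sortTime_le h4
      exact_mod_cast (by omega)
    refine hT.trans ?_
    push_cast
    -- With `1 ≤ x` and `m ≤ x + 1 ≤ 2 * x`, every lower-order term is absorbed by `n * x`; the last
    -- estimate also uses `2 ≤ n`.
    have e1 : (n : ℝ) ≤ n * x := by nlinarith
    have e2 : (n : ℝ) * m ≤ 2 * (n * x) := by nlinarith
    have e3 : (m : ℝ) ≤ n * x := by nlinarith
    nlinarith

theorem two_pow_max_clog_le (n : ℕ) : 2 ^ max 1 (Nat.clog 2 n) ≤ 2 * (n + 1) := by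
  rcases Nat.lt_or_ge n 2 with hn | hn
  · rw [Nat.clog_of_right_le_one (by omega) 2]
    simp
  · have hc : 1 ≤ Nat.clog 2 n := Nat.clog_pos (by norm_num) hn
    have := Nat.pow_pred_clog_lt_self (b := 2) (by norm_num) hn
    rw [max_eq_right hc, show Nat.clog 2 n = (Nat.clog 2 n).pred + 1 from
      (Nat.succ_pred_eq_of_pos hc).symm, pow_succ]
    simp only [Nat.pred_eq_sub_one] at *
    omega

/-- Choice of the cell width: all addresses lie below `10 * 2 ^ m`, which is at most `20 * (n + 1)`
and so at most `40 * 2 ^ (⌈C⌉₊ * w)`. Six more words per cell give a factor of at least `2 ^ 6`,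
even for `w = 1`. -/
theorem ten_mul_two_pow_le {C : ℝ} {w n : ℕ} (hw : 1 ≤ w) (h : Real.logb 2 n ≤ C * w) :
    10 * 2 ^ max 1 (Nat.clog 2 n) ≤ 2 ^ ((⌈C⌉₊ + 6) * w) := by
  have hn : n ≤ 2 ^ (⌈C⌉₊ * w) := by
    rcases Nat.eq_zero_or_pos n with rfl | hn
    · exact Nat.zero_le _
    have : (n : ℝ) ≤ 2 ^ ((⌈C⌉₊ * w : ℕ) : ℝ) := by
      rw [← Real.logb_le_iff_le_rpow (by norm_num) (by exact_mod_cast hn)]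
      push_cast
      exact h.trans (mul_le_mul_of_nonneg_right (Nat.le_ceil C) (Nat.cast_nonneg w))
    rw [Real.rpow_natCast] at this
    exact_mod_cast this
  have h1 := two_pow_max_clog_le n
  have h2 : 1 ≤ 2 ^ (⌈C⌉₊ * w) := Nat.one_le_two_pow
  calc 10 * 2 ^ max 1 (Nat.clog 2 n) ≤ 2 ^ (⌈C⌉₊ * w) * 2 ^ 6 := by omega
    _ ≤ 2 ^ ((⌈C⌉₊ + 6) * w) := by
      rw [← pow_add, add_mul]
      exact Nat.pow_le_pow_right (by norm_num) (by omega)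

end EnergyRAM

open EnergyRAM in
theorem mainTheorem1 (C : ℝ) :
    ∃ P : EnergyRAM.Program, P.Reversible ∧
      ∃ c₁ c₂ : ℝ, 0 < c₁ ∧ 0 < c₂ ∧
        ∀ w n : ℕ, 1 ≤ w → Real.logb 2 n ≤ C * w →
          ∀ L : Fin n → BitVec w,
            ∃ (R : Fin n → BitVec w) (T : ℕ) (A : Finset EnergyRAM.Cell),
              EnergyRAM.IsSortedCopy L R ∧
              P.Run (EnergyRAM.startConfig P L) T 0 A (EnergyRAM.endConfig P L R) ∧
              c₁ * (n * Real.logb 2 n) ≤ T ∧ T ≤ c₂ * (n * Real.logb 2 n + 1) ∧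
              c₁ * n ≤ EnergyRAM.auxWords P.K n A ∧
              EnergyRAM.auxWords P.K n A ≤ c₂ * (n + 1) := by
  set K := ⌈C⌉₊ + 6 with hK
  -- The constant `1000` serves the time. The summand `38 * K` serves the space: at most `18 + 10 *
  -- 2 ^ m ≤ 38 * (n + 1)` auxiliary cells of at most `K` words are accessed.
  refine ⟨sortProgram K, reversible_sortProgram K, 1, 1000 + 38 * K, one_pos, by positivity,
    fun w n hw hC L => ?_⟩
  set m := max 1 (Nat.clog 2 n) with hm
  have hn : n ≤ 2 ^ m := (Nat.le_pow_clog (by norm_num) n).trans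
    (Nat.pow_le_pow_right (by norm_num) (le_max_right _ _))
  have hlt : ∀ k, 1 ≤ k → k < m → 2 ^ k < n := fun k _ hk =>
    (Nat.lt_clog_iff_pow_lt (by norm_num)).1 (by omega)
  obtain ⟨A, hrun, hmem, hsub⟩ := exists_run_sortProgram (L := L) (ten_mul_two_pow_le hw hC)
    (le_max_left _ _) hn hlt
  obtain ⟨t₁, t₂⟩ := sortTime_bounds hm
  have hx : 0 ≤ n * Real.logb 2 n := by
    rcases Nat.eq_zero_or_pos n with rfl | h
    · simp
    · exact mul_nonneg (Nat.cast_nonneg n) (Real.logb_nonneg (by norm_num) (by exact_mod_cast h))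
  have hK1 : 1 ≤ K := by omega
  refine ⟨sortedArray L, _, A, isSortedCopy_sortedArray L, hrun, by simpa using t₁, ?_, ?_, ?_⟩
  · refine t₂.trans (mul_le_mul_of_nonneg_right ?_ (by linarith))
    have : (0 : ℝ) ≤ K := Nat.cast_nonneg K
    linarith
  · rw [one_mul]
    exact_mod_cast le_auxWords hK1 hmem
  · have h1 : auxWords K n A ≤ (17 + 10 * 2 ^ m + 1) * K :=
      auxWords_le (B := 10 * 2 ^ m) hK1 (by exact_mod_cast hsub)
    have h2 : (17 + 10 * 2 ^ m + 1) * K ≤ 38 * (n + 1) * K := by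
      have := two_pow_max_clog_le n
      rw [← hm] at this
      exact Nat.mul_le_mul_right _ (by omega)
    have h3 : (auxWords K n A : ℝ) ≤ 38 * (n + 1) * K := by exact_mod_cast h1.trans h2
    refine h3.trans ?_
    have : (0 : ℝ) ≤ n := Nat.cast_nonneg n
    nlinarith
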